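/- All Hilbert spaces are complex. $\mathbf{Hilb}$ is the category of Hilbert spaces and bounded linear maps, with the Hilbertian tensor product $\hat\otimes_2$ (the completion of the algebraic tensor product), associator $\alpha$ and symmetry $\sigma$; $f^\dagger$ denotes the Hilbert space adjoint of $f$. A *(commutative) Hilbertian Frobenius semigroup* is a Hilbert space $H$ with a bounded linear map $\mu\colon H\hat\otimes_2 H\to H$ that is associative and commutative and satisfies the Frobenius condition $$(\mu\hat\otimes_2 \mathrm{id})\circ\alpha^{-1}\circ(\mathrm{id}\hat\otimes_2\mu^\dagger)=\mu^\dagger\circ\mu=(\mathrm{id}\hat\otimes_2\mu)\circ\alpha\circ(\mu^\dagger\hat\otimes_2\mathrm{id}).$$ It is *semisimple* if its Jacobson radical, the intersection of all maximal modular ideals of the algebra $(H,\mu)$, is zero (the empty intersection being $H$). A semigroup morphism $f\colon (H,\mu)\to(K,\gamma)$ is a bounded linear map with $f\circ\mu=\gamma\circ(f\hat\otimes_2 f)$; it is *proper* if its range is not contained in any maximal modular ideal of $(K,\gamma)$. Let ${}_c\mathbf{FrobSem}(\mathbb{Hilb})_{\mathsf{proper}}$ be the category of commutative Hilbertian Frobenius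 semigroups and proper semigroup morphisms, and ${}_{\mathsf{semisimple},c}\mathbf{FrobSem}(\mathbb{FdHilb})_{\mathsf{proper}}$ its full subcategory of semisimple finite-dimensional objects. Let ${}_c\mathbf{FrobMon}(\mathbb{FdHilb})$ be the category of finite-dimensional Frobenius monoids $(H,\mu,\eta)$, that is, finite-dimensional commutative Hilbertian Frobenius semigroups $(H,\mu)$ with a unit $\eta\colon\mathbb{C}\to H$, and monoid morphisms (semigroup morphisms $f$ with $f\circ\eta=\eta'$). Let $\mathbf{WSet}$ be the category whose objects are the sets $X$ with a weight function $\alpha\colon X\to[C,+\infty[$ for some $C>0$, and whose morphisms $(X,\alpha)\to(Y,\beta)$ are the maps $f\colon X\to Y$ with finite fibres for which there is $M\ge 0$ with $\sum_{x\in f^{-1}(\{y\})}\alpha(x)\le M\beta(y)$ for all $y\in Y$. Let $\mathbf{FinSet}$ be the category of finite sets and all maps. Then one has the equivalences of categories $${}_c\mathbf{FrobSem}(\mathbb{Hilb})_{\mathsf{proper}}\simeq\mathbf{WSet}^{\mathsf{op}}\times\mathbf{Hilb}$$ and $${}_{\mathsf{semisimple},c}\mathbf{FrobSem}(\mathbb{FdHilb})_{\mathsf{proper}}\simeq{}_c\mathbf{FrobMon}(\mathbb{FdHilb})\simeq\mathbf{FinSet}^{\mathsf{op}}.$$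 -/

import Mathlib

open CategoryTheory
open scoped TensorProduct

universe u

namespace HilbFrob

noncomputable section

/-! ### The Hilbertian tensor product -/

section Tensor

variable {E F G E' F' : Type*}
  [NormedAddCommGroup E] [InnerProductSpace ℂ E]
  [NormedAddCommGroup F] [InnerProductSpace ℂ F]
  [NormedAddCommGroup G] [InnerProductSpace ℂ G]
  [NormedAddCommGroup E'] [InnerProductSpace ℂ E']
  [NormedAddCommGroup F'] [InnerProductSpace ℂ F']

/-- The Hilbertian tensor product of two complex Hilbert spaces: the completion of the algebraic
tensor product for the inner product `⟪a ⊗ b, c ⊗ d⟫ = ⟪a, c⟫ * ⟪b, d⟫`. -/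
abbrev HTensor (E F : Type*) [NormedAddCommGroup E] [InnerProductSpace ℂ E]
    [NormedAddCommGroup F] [InnerProductSpace ℂ F] : Type _ :=
  UniformSpace.Completion (E ⊗[ℂ] F)

namespace HTensor

/-- The inclusion of the algebraic tensor product in the Hilbertian tensor product. -/
def incl (E F : Type*) [NormedAddCommGroup E] [InnerProductSpace ℂ E]
    [NormedAddCommGroup F] [InnerProductSpace ℂ F] : E ⊗[ℂ] F →ₗᵢ[ℂ] HTensor E F :=
  UniformSpace.Completion.toComplₗᵢ

/-- The elementary tensor `x ⊗ y`. -/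
def tmul (x : E) (y : F) : HTensor E F := incl E F (x ⊗ₜ[ℂ] y)

theorem denseRange_incl : DenseRange (incl E F) := UniformSpace.Completion.denseRange_coe

theorem inner_tmul (a c : E) (b d : F) :
    inner ℂ (tmul a b) (tmul c d) = inner ℂ a c * inner ℂ b d := by
  simp [tmul]

/-- The tensor product of two bounded linear maps. -/
def map (f : E →L[ℂ] E') (g : F →L[ℂ] F') : HTensor E F →L[ℂ] HTensor E' F' :=
  (TensorProduct.mapL f g).completion

theorem map_tmul (f : E →L[ℂ] E') (g : F →L[ℂ] F') (x : E) (y : F) :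
    map f g (tmul x y) = tmul (f x) (g y) :=
  UniformSpace.Completion.map_coe (TensorProduct.mapL f g).uniformContinuous (x ⊗ₜ[ℂ] y)

theorem clm_ext {L : Type*} [NormedAddCommGroup L] [NormedSpace ℂ L]
    {f g : HTensor E F →L[ℂ] L} (h : ∀ x y, f (tmul x y) = g (tmul x y)) : f = g := by
  have h' : (f ∘L (incl E F).toContinuousLinearMap).toLinearMap
      = (g ∘L (incl E F).toContinuousLinearMap).toLinearMap :=
    TensorProduct.ext' h
  exact ContinuousLinearMap.coeFn_injective
    (denseRange_incl.equalizer f.continuous g.continuous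
      (funext fun t => LinearMap.congr_fun h' t))

theorem map_id : map (.id ℂ E) (.id ℂ F) = .id ℂ (HTensor E F) :=
  clm_ext fun x y => by simp [map_tmul]

theorem map_comp_map {E'' F'' : Type*}
    [NormedAddCommGroup E''] [InnerProductSpace ℂ E'']
    [NormedAddCommGroup F''] [InnerProductSpace ℂ F'']
    (f' : E' →L[ℂ] E'') (g' : F' →L[ℂ] F'') (f : E →L[ℂ] E') (g : F →L[ℂ] F') :
    map f' g' ∘L map f g = map (f' ∘L f) (g' ∘L g) :=
  clm_ext fun x y => by simp [map_tmul]

theorem continuous_tmul : Continuous fun p : E × F => tmul p.1 p.2 :=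
  (incl E F).continuous.comp TensorProduct.continuous_tmul

theorem dense_of_tmul_mem {S : Submodule ℂ (HTensor E F)} (hS : IsClosed (S : Set (HTensor E F)))
    (h : ∀ x y, tmul x y ∈ S) : S = ⊤ := by
  have h1 : ∀ t : E ⊗[ℂ] F, incl E F t ∈ S := fun t => by
    induction t using TensorProduct.induction_on with
    | zero => simp
    | tmul x y => exact h x y
    | add a b ha hb => rw [map_add]; exact S.add_mem ha hb
  exact eq_top_iff.2 fun t _ =>
    isClosed_property (p := fun t => t ∈ S) denseRange_incl hS h1 t

/-- The isometric embedding of `(E ⊗ F) ⊗ G` (algebraic) in its twofold completion. -/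
def inclLeft (E F G : Type*) [NormedAddCommGroup E] [InnerProductSpace ℂ E]
    [NormedAddCommGroup F] [InnerProductSpace ℂ F] [NormedAddCommGroup G]
    [InnerProductSpace ℂ G] : (E ⊗[ℂ] F) ⊗[ℂ] G →ₗᵢ[ℂ] HTensor (HTensor E F) G :=
  (incl (HTensor E F) G).comp (TensorProduct.mapIsometry (incl E F) .id)

/-- The isometric embedding of `E ⊗ (F ⊗ G)` (algebraic) in its twofold completion. -/
def inclRight (E F G : Type*) [NormedAddCommGroup E] [InnerProductSpace ℂ E]
    [NormedAddCommGroup F] [InnerProductSpace ℂ F] [NormedAddCommGroup G]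
    [InnerProductSpace ℂ G] : E ⊗[ℂ] (F ⊗[ℂ] G) →ₗᵢ[ℂ] HTensor E (HTensor F G) :=
  (incl E (HTensor F G)).comp (TensorProduct.mapIsometry .id (incl F G))

theorem denseRange_inclLeft : DenseRange (inclLeft E F G).toLinearMap := by
  have h := dense_of_tmul_mem (E := HTensor E F) (F := G)
    (S := (LinearMap.range (inclLeft E F G).toLinearMap).topologicalClosure)
    (Submodule.isClosed_topologicalClosure _) fun x y => by
      refine isClosed_property
        (p := fun x => tmul x y ∈ (LinearMap.range (inclLeft E F G).toLinearMap).topologicalClosure)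
        (denseRange_incl (E := E) (F := F)) ?_ ?_ x
      · exact (Submodule.isClosed_topologicalClosure _).preimage
          (continuous_tmul.comp (Continuous.prodMk_left y))
      · exact fun t => Submodule.le_topologicalClosure _ ⟨t ⊗ₜ[ℂ] y, rfl⟩
  intro t
  have ht : t ∈ (LinearMap.range (inclLeft E F G).toLinearMap).topologicalClosure := by
    rw [h]; trivial
  exact ht

theorem denseRange_inclRight : DenseRange (inclRight E F G).toLinearMap := by
  have h := dense_of_tmul_mem (E := E) (F := HTensor F G)
    (S := (LinearMap.range (inclRight E F G).toLinearMap).topologicalClosure)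
    (Submodule.isClosed_topologicalClosure _) fun x y => by
      refine isClosed_property
        (p := fun y => tmul x y ∈
          (LinearMap.range (inclRight E F G).toLinearMap).topologicalClosure)
        (denseRange_incl (E := F) (F := G)) ?_ ?_ y
      · exact (Submodule.isClosed_topologicalClosure _).preimage
          (continuous_tmul.comp (Continuous.prodMk_right x))
      · exact fun t => Submodule.le_topologicalClosure _ ⟨x ⊗ₜ[ℂ] t, rfl⟩
  intro t
  have ht : t ∈ (LinearMap.range (inclRight E F G).toLinearMap).topologicalClosure := by
    rw [h]; trivial
  exact ht

/-- The unitary associator `(x ⊗ y) ⊗ z ↦ x ⊗ (y ⊗ z)`. -/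
def assoc (E F G : Type*) [NormedAddCommGroup E] [InnerProductSpace ℂ E]
    [NormedAddCommGroup F] [InnerProductSpace ℂ F] [NormedAddCommGroup G]
    [InnerProductSpace ℂ G] : HTensor (HTensor E F) G ≃ₗᵢ[ℂ] HTensor E (HTensor F G) :=
  (TensorProduct.assoc ℂ E F G).extendOfIsometry
    (inclLeft E F G).toLinearMap (inclRight E F G).toLinearMap
    denseRange_inclLeft denseRange_inclRight fun x => by
      simp only [LinearIsometry.coe_toLinearMap, LinearIsometry.norm_map, TensorProduct.norm_assoc]

theorem assoc_tmul (x : E) (y : F) (z : G) :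
    assoc E F G (tmul (tmul x y) z) = tmul x (tmul y z) :=
  LinearEquiv.extendOfIsometry_eq (TensorProduct.assoc ℂ E F G)
    (e₁ := (inclLeft E F G).toLinearMap) (e₂ := (inclRight E F G).toLinearMap)
    denseRange_inclLeft denseRange_inclRight
    (fun x => by
      simp only [LinearIsometry.coe_toLinearMap, LinearIsometry.norm_map, TensorProduct.norm_assoc])
    ((x ⊗ₜ[ℂ] y) ⊗ₜ[ℂ] z)

/-- The symmetry `x ⊗ y ↦ y ⊗ x`. -/
def comm (E F : Type*) [NormedAddCommGroup E] [InnerProductSpace ℂ E]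
    [NormedAddCommGroup F] [InnerProductSpace ℂ F] : HTensor E F →L[ℂ] HTensor F E :=
  (TensorProduct.commIsometry ℂ E F).toContinuousLinearEquiv.toContinuousLinearMap.completion

theorem comm_tmul (x : E) (y : F) : comm E F (tmul x y) = tmul y x :=
  UniformSpace.Completion.map_coe
    (TensorProduct.commIsometry ℂ E F).toContinuousLinearEquiv.toContinuousLinearMap.uniformContinuous
    (x ⊗ₜ[ℂ] y)

/-- The left unit constraint `c ⊗ x ↦ c • x`. -/
def lid (E : Type*) [NormedAddCommGroup E] [InnerProductSpace ℂ E] [CompleteSpace E] :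
    HTensor ℂ E →L[ℂ] E :=
  (TensorProduct.lidIsometry ℂ E).toContinuousLinearEquiv.toContinuousLinearMap.extend
    (incl ℂ E).toContinuousLinearMap

theorem lid_tmul [CompleteSpace E] (c : ℂ) (x : E) : lid E (tmul c x) = c • x :=
  ContinuousLinearMap.extend_eq
    (TensorProduct.lidIsometry ℂ E).toContinuousLinearEquiv.toContinuousLinearMap
    (e := (incl ℂ E).toContinuousLinearMap) denseRange_incl
    (incl ℂ E).isometry.isUniformInducing (c ⊗ₜ[ℂ] x)

/-- The right unit constraint `x ⊗ c ↦ c • x`. -/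
def rid (E : Type*) [NormedAddCommGroup E] [InnerProductSpace ℂ E] [CompleteSpace E] :
    HTensor E ℂ →L[ℂ] E :=
  lid E ∘L comm E ℂ

end HTensor

end Tensor

/-! ### Ideals and the Jacobson radical -/

section Ideals

variable {H K L : Type*}
  [NormedAddCommGroup H] [InnerProductSpace ℂ H]
  [NormedAddCommGroup K] [InnerProductSpace ℂ K]
  [NormedAddCommGroup L] [InnerProductSpace ℂ L]

/-- A (two-sided, algebra) ideal of `(H, μ)`. -/
def IsIdeal (μ : HTensor H H →L[ℂ] H) (I : Submodule ℂ H) : Prop :=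
  ∀ a x : H, x ∈ I → μ (.tmul a x) ∈ I ∧ μ (.tmul x a) ∈ I

/-- An ideal `I` is modular when there is a unit modulo `I`. -/
def IsModular (μ : HTensor H H →L[ℂ] H) (I : Submodule ℂ H) : Prop :=
  ∃ u : H, ∀ x : H, μ (.tmul u x) - x ∈ I ∧ μ (.tmul x u) - x ∈ I

/-- A maximal modular ideal: a modular ideal which is maximal among the proper ideals. -/
structure IsMaximalModularIdeal (μ : HTensor H H →L[ℂ] H) (I : Submodule ℂ H) : Prop where
  isIdeal : IsIdeal μ I
  modular : IsModular μ I
  ne_top : I ≠ ⊤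
  maximal : ∀ I' : Submodule ℂ H, IsIdeal μ I' → I ≤ I' → I' ≠ ⊤ → I' = I

/-- The Jacobson radical: the intersection of all maximal modular ideals (all of `H` if there
is none). -/
def jacobsonRadical (μ : HTensor H H →L[ℂ] H) : Submodule ℂ H :=
  sInf {I | IsMaximalModularIdeal μ I}

/-- `f` is multiplicative: `f ∘ μ = γ ∘ (f ⊗ f)`. -/
def IsSemigroupMap (μ : HTensor H H →L[ℂ] H) (γ : HTensor K K →L[ℂ] K) (f : H →L[ℂ] K) : Prop :=
  f ∘L μ = γ ∘L HTensor.map f f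

/-- `f` is proper: its range is not contained in any maximal modular ideal of its codomain. -/
def IsProper (γ : HTensor K K →L[ℂ] K) (f : H →L[ℂ] K) : Prop :=
  ∀ I : Submodule ℂ K, IsMaximalModularIdeal γ I → ¬ LinearMap.range f.toLinearMap ≤ I

/-- Associativity, `μ ∘ (μ ⊗ id) = μ ∘ (id ⊗ μ) ∘ α`, and commutativity, `μ ∘ σ = μ`. -/
structure IsCommSemigroup (μ : HTensor H H →L[ℂ] H) : Prop where
  assoc : μ ∘L HTensor.map μ (.id ℂ H) =
    μ ∘L HTensor.map (.id ℂ H) μ ∘L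
      (HTensor.assoc H H H).toContinuousLinearEquiv.toContinuousLinearMap
  comm : μ ∘L HTensor.comm H H = μ

theorem IsSemigroupMap.apply {μ : HTensor H H →L[ℂ] H} {γ : HTensor K K →L[ℂ] K}
    {f : H →L[ℂ] K} (h : IsSemigroupMap μ γ f) (x y : H) :
    f (μ (.tmul x y)) = γ (.tmul (f x) (f y)) := by
  have := congrArg (fun g => g (HTensor.tmul x y)) h
  simpa [HTensor.map_tmul] using this

theorem IsSemigroupMap.id (μ : HTensor H H →L[ℂ] H) : IsSemigroupMap μ μ (.id ℂ H) := by
  simp [IsSemigroupMap, HTensor.map_id]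

theorem IsSemigroupMap.comp {μ : HTensor H H →L[ℂ] H} {γ : HTensor K K →L[ℂ] K}
    {ρ : HTensor L L →L[ℂ] L} {g : K →L[ℂ] L} {f : H →L[ℂ] K}
    (hg : IsSemigroupMap γ ρ g) (hf : IsSemigroupMap μ γ f) : IsSemigroupMap μ ρ (g ∘L f) :=
  HTensor.clm_ext fun x y => by simp [hf.apply, hg.apply, HTensor.map_tmul]

theorem IsCommSemigroup.mul_comm {μ : HTensor H H →L[ℂ] H} (h : IsCommSemigroup μ) (x y : H) :
    μ (.tmul x y) = μ (.tmul y x) := by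
  have := congrArg (fun g => g (HTensor.tmul y x)) h.comm
  simpa [HTensor.comm_tmul] using this

theorem IsCommSemigroup.mul_assoc {μ : HTensor H H →L[ℂ] H} (h : IsCommSemigroup μ) (x y z : H) :
    μ (.tmul (μ (.tmul x y)) z) = μ (.tmul x (μ (.tmul y z))) := by
  have := congrArg (fun g => g (HTensor.tmul (HTensor.tmul x y) z)) h.assoc
  simpa [HTensor.map_tmul, HTensor.assoc_tmul] using this

theorem IsProper.id (μ : HTensor H H →L[ℂ] H) : IsProper μ (.id ℂ H) := fun _ hI h =>
  hI.ne_top (eq_top_iff.2 fun x _ => h ⟨x, rfl⟩)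

/-- The underlying bounded bilinear map. -/
def bil (μ : HTensor H H →L[ℂ] H) : H →L[ℂ] H →L[ℂ] H :=
  (ContinuousLinearMap.compL ℂ H (H ⊗[ℂ] H) H (μ ∘L (HTensor.incl H H).toContinuousLinearMap)) ∘L
    TensorProduct.mkL ℂ H H

theorem bil_apply (μ : HTensor H H →L[ℂ] H) (x y : H) : bil μ x y = μ (.tmul x y) := rfl

theorem IsMaximalModularIdeal.isClosed [CompleteSpace H] {μ : HTensor H H →L[ℂ] H}
    {I : Submodule ℂ H} (hI : IsMaximalModularIdeal μ I) : IsClosed (I : Set H) := by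
  by_cases htop : I.topologicalClosure = ⊤
  · exfalso
    obtain ⟨u, hu⟩ := hI.modular
    have hmem : u ∈ closure (I : Set H) := by
      rw [← Submodule.topologicalClosure_coe, htop]; trivial
    have hcont : Continuous fun m => ‖bil μ (u - m)‖ := by fun_prop
    have hopen : IsOpen {m | ‖bil μ (u - m)‖ < 1} := isOpen_lt hcont continuous_const
    obtain ⟨m, hm1, hm2⟩ := mem_closure_iff.1 hmem _ hopen (by simp)
    obtain ⟨V, hV⟩ := (isUnit_one_sub_of_norm_lt_one hm1).exists_right_inv
    refine hI.ne_top (eq_top_iff.2 fun z _ => ?_)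
    have hz : V z - (bil μ u (V z) - bil μ m (V z)) = z := by
      simpa using congrArg (fun g => g z) hV
    have h1 : bil μ u (V z) - V z ∈ I := (hu (V z)).1
    have h2 : bil μ m (V z) ∈ I := (hI.isIdeal (V z) m hm2).2
    rw [← hz]
    have : V z - (bil μ u (V z) - bil μ m (V z)) =
        bil μ m (V z) - (bil μ u (V z) - V z) := by abel
    rw [this]
    exact I.sub_mem h2 h1
  · have hid : IsIdeal μ I.topologicalClosure := by
      intro a x hx
      constructor
      · exact map_mem_closure (f := fun x => bil μ a x) (by fun_prop) hx
          fun y hy => (hI.isIdeal a y hy).1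
      · exact map_mem_closure (f := fun x => bil μ x a) (by fun_prop) hx
          fun y hy => (hI.isIdeal a y hy).2
    rw [← hI.maximal _ hid I.le_topologicalClosure htop]
    exact I.isClosed_topologicalClosure

/-- A maximal modular ideal of a commutative Hilbertian algebra is the kernel of a nonzero
character (Gelfand--Mazur). -/
theorem IsMaximalModularIdeal.exists_character [CompleteSpace H] {μ : HTensor H H →L[ℂ] H}
    (hμ : IsCommSemigroup μ) {I : Submodule ℂ H} (hI : IsMaximalModularIdeal μ I) :
    ∃ χ : H →ₗ[ℂ] ℂ, (∀ x y, χ (μ (.tmul x y)) = χ x * χ y) ∧ LinearMap.ker χ = I := by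
  obtain ⟨u, hu⟩ := hI.modular
  have hu1 : ∀ x, bil μ u x - x ∈ I := fun x => (hu x).1
  have hl : ∀ a x, x ∈ I → bil μ a x ∈ I := fun a x hx => (hI.isIdeal a x hx).1
  have hr : ∀ a x, x ∈ I → bil μ x a ∈ I := fun a x hx => (hI.isIdeal a x hx).2
  have hassoc : ∀ x y z, bil μ (bil μ x y) z = bil μ x (bil μ y z) := hμ.mul_assoc
  have hcomm : ∀ x y, bil μ x y = bil μ y x := hμ.mul_comm
  have huI : u ∉ I := fun h => hI.ne_top (eq_top_iff.2 fun x _ => by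
    simpa using I.sub_mem (hr x u h) (hu1 x))
  have hcl := hI.isClosed
  let T : H → ((H ⧸ I) →L[ℂ] (H ⧸ I)) := fun x =>
    { toLinearMap := I.mapQ I (bil μ x).toLinearMap fun y hy => hl x y hy
      cont := by
        refine I.isOpenQuotientMap_mkQ.isQuotientMap.continuous_iff.2 ?_
        exact I.isOpenQuotientMap_mkQ.continuous.comp (bil μ x).continuous }
  have hT : ∀ x y, T x (I.mkQ y) = I.mkQ (bil μ x y) := fun x y => rfl
  have hText : ∀ {f g : (H ⧸ I) →L[ℂ] (H ⧸ I)}, (∀ y, f (I.mkQ y) = g (I.mkQ y)) → f = g := by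
    intro f g h
    ext q
    obtain ⟨y, rfl⟩ := I.mkQ_surjective q
    exact h y
  have hmk : ∀ {x y : H}, x - y ∈ I → I.mkQ x = I.mkQ y := fun h =>
    (Submodule.Quotient.eq I).2 h
  have : Nontrivial (H ⧸ I) := Submodule.Quotient.nontrivial_iff.2 hI.ne_top
  have key : ∀ x, ∃ c : ℂ, x - c • u ∈ I := by
    intro x
    obtain ⟨c, hc⟩ := spectrum.nonempty (T x)
    refine ⟨c, ?_⟩
    by_contra hw
    have hTw : T (x - c • u) = T x - algebraMap ℂ _ c := by
      refine hText fun y => ?_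
      have : T u (I.mkQ y) = I.mkQ y := hmk (hu1 y)
      simp only [hT, map_sub, map_smul, sub_apply,
        smul_apply, Algebra.algebraMap_eq_smul_one,
        one_apply_eq_self] at this ⊢
      rw [this]
    set w := x - c • u with hwdef
    let I' : Submodule ℂ H := LinearMap.range (bil μ w).toLinearMap ⊔ I
    have hwI' : w ∈ I' := by
      refine Submodule.mem_sup.2 ⟨bil μ w u, ⟨u, rfl⟩, -(bil μ u w - w), I.neg_mem (hu1 w), ?_⟩
      rw [hcomm w u]; abel
    have hid' : ∀ a z, z ∈ I' → bil μ a z ∈ I' := by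
      intro a z hz
      obtain ⟨_, ⟨b, rfl⟩, m, hm, rfl⟩ := Submodule.mem_sup.1 hz
      refine Submodule.mem_sup.2 ⟨bil μ w (bil μ a b), ⟨_, rfl⟩, bil μ a m, hl a m hm, ?_⟩
      rw [map_add]
      congr 1
      change _ = bil μ a (bil μ w b)
      rw [← hassoc, hcomm w a, hassoc]
    have htop : I' = ⊤ := by
      by_contra hne
      refine hw ?_
      rw [← hI.maximal I' (fun a z hz => ⟨hid' a z hz, ?_⟩) le_sup_right hne]
      · exact hwI'
      · have h := hid' a z hz
        rw [hcomm] at h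
        exact h
    have humem : u ∈ I' := by rw [htop]; trivial
    obtain ⟨_, ⟨b, rfl⟩, m, hm, hsum⟩ := Submodule.mem_sup.1 humem
    have h1 : T w * T b = 1 := by
      refine hText fun y => ?_
      change I.mkQ (bil μ w (bil μ b y)) = I.mkQ y
      refine hmk ?_
      have : bil μ w (bil μ b y) - y = (bil μ u y - y) - bil μ m y := by
        rw [← hsum, ← hassoc]
        simp only [map_add, add_apply, ContinuousLinearMap.coe_coe]
        abel
      rw [this]
      exact I.sub_mem (hu1 y) (hr y m hm)
    have h2 : T b * T w = T w * T b := by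
      refine hText fun y => ?_
      change I.mkQ (bil μ b (bil μ w y)) = I.mkQ (bil μ w (bil μ b y))
      rw [← hassoc, hcomm b w, hassoc]
    have hunit : IsUnit (T w) := ⟨⟨T w, T b, h1, h2.trans h1⟩, rfl⟩
    rw [hTw] at hunit
    apply spectrum.mem_iff.1 hc
    rw [← neg_sub]
    exact hunit.neg
  obtain ⟨f, hfu, hfI⟩ := Submodule.exists_le_ker_of_notMem huI
  have hfI' : ∀ x ∈ I, f x = 0 := fun x hx => hfI hx
  have hχ : ∀ x (c : ℂ), x - c • u ∈ I → f x = c * f u := by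
    intro x c h
    have := hfI' _ h
    rw [map_sub, map_smul, smul_eq_mul, sub_eq_zero] at this
    exact this
  refine ⟨(f u)⁻¹ • f, ?_, ?_⟩
  · intro x y
    obtain ⟨c, hc⟩ := key x
    have h1 : bil μ x y - c • y ∈ I := by
      have h2 : bil μ x y - c • y = bil μ (x - c • u) y + c • (bil μ u y - y) := by
        simp only [map_sub, map_smul, sub_apply,
          smul_apply, smul_sub]
        abel
      rw [h2]
      exact I.add_mem (hr y _ hc) (I.smul_mem c (hu1 y))
    have h3 : f (bil μ x y) = c * f y := by
      have := hfI' _ h1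
      rw [map_sub, map_smul, smul_eq_mul, sub_eq_zero] at this
      exact this
    rw [bil_apply] at h3
    simp only [LinearMap.smul_apply, smul_eq_mul, h3, hχ x c hc]
    field_simp
  · refine le_antisymm (fun x hx => ?_) (fun x hx => ?_)
    · obtain ⟨c, hc⟩ := key x
      have hx0 : (f u)⁻¹ * f x = 0 := hx
      rw [hχ x c hc] at hx0
      have : c = 0 := by simpa [hfu] using hx0
      simpa [this] using hc
    · simp [hfI' x hx]

/-- The kernel of a nonzero character is a maximal modular ideal. -/
theorem isMaximalModularIdeal_ker {μ : HTensor H H →L[ℂ] H} {χ : H →ₗ[ℂ] ℂ}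
    (hχ : ∀ x y, χ (μ (.tmul x y)) = χ x * χ y) (h0 : χ ≠ 0) :
    IsMaximalModularIdeal μ (LinearMap.ker χ) := by
  obtain ⟨v, hv⟩ : ∃ v, χ v ≠ 0 := by
    by_contra! h
    exact h0 (LinearMap.ext h)
  have hu : χ ((χ v)⁻¹ • v) = 1 := by simp [hv]
  refine ⟨fun a x hx => ?_, ⟨(χ v)⁻¹ • v, fun x => ?_⟩, ?_, ?_⟩
  · have hx' : χ x = 0 := hx
    simp [LinearMap.mem_ker, hχ, hx']
  · simp only [LinearMap.mem_ker, map_sub, hχ, hu]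
    simp
  · intro h
    exact hv (LinearMap.mem_ker.1 (h ▸ Submodule.mem_top))
  · intro I' _ hle hne
    refine le_antisymm (fun x hx => ?_) hle
    by_contra hxk
    have hxk' : χ x ≠ 0 := hxk
    refine hne (eq_top_iff.2 fun y _ => ?_)
    have h1 : y - (χ y / χ x) • x ∈ I' := hle (by
      simp [LinearMap.mem_ker, hxk'])
    simpa using I'.add_mem h1 (I'.smul_mem (χ y / χ x) hx)

theorem IsProper.comp [CompleteSpace L] {γ : HTensor K K →L[ℂ] K}
    {ρ : HTensor L L →L[ℂ] L} (hρ : IsCommSemigroup ρ)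
    {g : K →L[ℂ] L} {f : H →L[ℂ] K}
    (hgm : IsSemigroupMap γ ρ g) (hg : IsProper ρ g) (hf : IsProper γ f) :
    IsProper ρ (g ∘L f) := by
  intro I hI hle
  obtain ⟨χ, hχ, rfl⟩ := hI.exists_character hρ
  have hker := isMaximalModularIdeal_ker (μ := γ) (χ := χ ∘ₗ g.toLinearMap)
    (fun x y => by simp [hgm.apply, hχ]) (fun h0 => hg _ hI (by
      rintro _ ⟨x, rfl⟩
      exact LinearMap.congr_fun h0 x))
  refine hf _ hker ?_
  rintro _ ⟨x, rfl⟩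
  exact hle ⟨x, rfl⟩

/-- The `†`-Frobenius condition: both cells of the Frobenius diagram commute, that is
`(μ ⊗ id) ∘ α⁻¹ ∘ (id ⊗ μ†) = μ† ∘ μ` and `(id ⊗ μ) ∘ α ∘ (μ† ⊗ id) = μ† ∘ μ`, where `μ†` is the
Hilbert space adjoint of `μ`. -/
structure IsFrobenius [CompleteSpace H] (μ : HTensor H H →L[ℂ] H) : Prop where
  upper : HTensor.map μ (.id ℂ H) ∘L
      (HTensor.assoc H H H).symm.toContinuousLinearEquiv.toContinuousLinearMap ∘L
      HTensor.map (.id ℂ H) (ContinuousLinearMap.adjoint μ) =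
    ContinuousLinearMap.adjoint μ ∘L μ
  lower : HTensor.map (.id ℂ H) μ ∘L
      (HTensor.assoc H H H).toContinuousLinearEquiv.toContinuousLinearMap ∘L
      HTensor.map (ContinuousLinearMap.adjoint μ) (.id ℂ H) =
    ContinuousLinearMap.adjoint μ ∘L μ

end Ideals

/-! ### The categories -/

/-- Complex Hilbert spaces. -/
structure Hilb : Type (u + 1) where
  carrier : Type u
  [normedAddCommGroup : NormedAddCommGroup carrier]
  [innerProductSpace : InnerProductSpace ℂ carrier]
  [completeSpace : CompleteSpace carrier]

namespace Hilb

instance : CoeSort Hilb.{u} (Type u) := ⟨Hilb.carrier⟩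

instance (H : Hilb.{u}) : NormedAddCommGroup H := H.normedAddCommGroup

instance (H : Hilb.{u}) : InnerProductSpace ℂ H := H.innerProductSpace

instance (H : Hilb.{u}) : CompleteSpace H := H.completeSpace

/-- The category of complex Hilbert spaces and bounded linear maps. -/
instance : Category Hilb.{u} where
  Hom H K := H →L[ℂ] K
  id H := .id ℂ H
  comp f g := g ∘L f

end Hilb

/-- Commutative Hilbertian Frobenius semigroups. -/
structure FrobSem : Type (u + 1) extends Hilb.{u} where
  mul : HTensor toHilb toHilb →L[ℂ] toHilb
  isCommSemigroup : IsCommSemigroup mul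
  isFrobenius : IsFrobenius mul

/-- A commutative Hilbertian Frobenius semigroup is semisimple when its Jacobson radical is zero. -/
def FrobSem.IsSemisimple (A : FrobSem.{u}) : Prop := jacobsonRadical A.mul = ⊥

/-- Proper semigroup morphisms. -/
@[ext]
structure FrobSem.ProperHom (A B : FrobSem.{u}) : Type u where
  toCLM : A.toHilb →L[ℂ] B.toHilb
  isSemigroupMap : IsSemigroupMap A.mul B.mul toCLM
  isProper : IsProper B.mul toCLM

/-- The category of commutative Hilbertian Frobenius semigroups and proper semigroup morphisms. -/
instance FrobSem.properCategory : Category FrobSem.{u} where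
  Hom A B := FrobSem.ProperHom A B
  id A := ⟨.id ℂ A.toHilb, IsSemigroupMap.id A.mul, IsProper.id A.mul⟩
  comp {_ _ C} f g := ⟨g.toCLM ∘L f.toCLM, g.isSemigroupMap.comp f.isSemigroupMap,
    IsProper.comp C.isCommSemigroup g.isSemigroupMap g.isProper f.isProper⟩

/-- Finite-dimensional semisimple commutative Hilbertian Frobenius semigroups. -/
def isSemisimpleFd : ObjectProperty FrobSem.{u} :=
  fun A => A.IsSemisimple ∧ FiniteDimensional ℂ A.toHilb

/-- The category of finite-dimensional semisimple commutative Hilbertian Frobenius semigroups and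
proper semigroup morphisms. -/
abbrev SemisimpleFdFrobSem : Type (u + 1) := isSemisimpleFd.{u}.FullSubcategory

/-- Finite-dimensional commutative Hilbertian Frobenius monoids `(H, μ, η)`. -/
structure FdFrobMon : Type (u + 1) extends FrobSem.{u} where
  unit : ℂ →L[ℂ] toHilb
  finiteDimensional : FiniteDimensional ℂ toHilb
  unit_mul : mul ∘L HTensor.map unit (.id ℂ toHilb) = HTensor.lid toHilb
  mul_unit : mul ∘L HTensor.map (.id ℂ toHilb) unit = HTensor.rid toHilb

/-- Morphisms of monoids. -/
@[ext]
structure FdFrobMon.Hom (A B : FdFrobMon.{u}) : Type u where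
  toCLM : A.toHilb →L[ℂ] B.toHilb
  isSemigroupMap : IsSemigroupMap A.mul B.mul toCLM
  map_unit : toCLM ∘L A.unit = B.unit

/-- The category of finite-dimensional commutative Hilbertian Frobenius monoids. -/
instance : Category FdFrobMon.{u} where
  Hom A B := FdFrobMon.Hom A B
  id A := ⟨.id ℂ A.toHilb, IsSemigroupMap.id A.mul, ContinuousLinearMap.id_comp _⟩
  comp f g := ⟨g.toCLM ∘L f.toCLM, g.isSemigroupMap.comp f.isSemigroupMap, by
    rw [ContinuousLinearMap.comp_assoc, f.map_unit, g.map_unit]⟩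

/-- Weighted sets: sets `X` with a weight function `X → [C, +∞[` for some `C > 0`. -/
structure WSet : Type (u + 1) where
  carrier : Type u
  weight : carrier → ℝ
  weight_bound : ∃ C : ℝ, 0 < C ∧ ∀ x, C ≤ weight x

/-- Maps `f` with finite fibres for which there is `M ≥ 0` such that the total weight of the fibre
of each `y` is at most `M` times the weight of `y`. -/
@[ext]
structure WSet.Hom (X Y : WSet.{u}) : Type u where
  toFun : X.carrier → Y.carrier
  finite_fiber : ∀ y, (toFun ⁻¹' {y}).Finite
  weight_le : ∃ M : ℝ, 0 ≤ M ∧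
    ∀ y, ∑ x ∈ (finite_fiber y).toFinset, X.weight x ≤ M * Y.weight y

/-- The identity map of a weighted set. -/
def WSet.Hom.id (X : WSet.{u}) : WSet.Hom X X where
  toFun x := x
  finite_fiber y := Set.finite_singleton y
  weight_le := ⟨1, zero_le_one, fun y => by
    have h' : ∀ hf : ((fun x => x) ⁻¹' {y} : Set X.carrier).Finite, hf.toFinset = {y} := by
      intro hf; ext; simp
    rw [h']; simp⟩

/-- Composition of morphisms of weighted sets. -/
def WSet.Hom.comp {X Y Z : WSet.{u}} (f : WSet.Hom X Y) (g : WSet.Hom Y Z) : WSet.Hom X Z where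
  toFun x := g.toFun (f.toFun x)
  finite_fiber z := by
    have h := (g.finite_fiber z).biUnion fun y _ => f.finite_fiber y
    refine h.subset fun x hx => ?_
    exact Set.mem_biUnion (x := f.toFun x) hx rfl
  weight_le := by
    classical
    obtain ⟨M, hM, hf⟩ := f.weight_le
    obtain ⟨N, hN, hg⟩ := g.weight_le
    refine ⟨M * N, mul_nonneg hM hN, fun z => ?_⟩
    have hfib : ∀ h : ((fun x => g.toFun (f.toFun x)) ⁻¹' {z}).Finite,
        h.toFinset = (g.finite_fiber z).toFinset.biUnion fun y => (f.finite_fiber y).toFinset := by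
      intro h; ext x; simp
    rw [hfib, Finset.sum_biUnion]
    · calc ∑ y ∈ (g.finite_fiber z).toFinset, ∑ x ∈ (f.finite_fiber y).toFinset, X.weight x
          ≤ ∑ y ∈ (g.finite_fiber z).toFinset, M * Y.weight y :=
            Finset.sum_le_sum fun y _ => hf y
        _ = M * ∑ y ∈ (g.finite_fiber z).toFinset, Y.weight y := (Finset.mul_sum ..).symm
        _ ≤ M * (N * Z.weight z) := mul_le_mul_of_nonneg_left (hg z) hM
        _ = M * N * Z.weight z := (mul_assoc ..).symm
    · intro y _ y' _ hne
      refine Finset.disjoint_left.2 fun x hx hx' => hne ?_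
      simp only [Set.Finite.mem_toFinset, Set.mem_preimage, Set.mem_singleton_iff] at hx hx'
      rw [← hx, ← hx']

/-- The category of weighted sets. -/
instance : Category WSet.{u} where
  Hom X Y := WSet.Hom X Y
  id X := WSet.Hom.id X
  comp f g := WSet.Hom.comp f g

end

end HilbFrob

/-!
The Frobenius condition says that the adjoint of each multiplication operator `L_a` is a module map,
so the multiplications form a commuting family of normal operators. For fixed `c`, the
conjugate-linear operator `a ↦ L_a† c` contracts the Hilbertian tensor `μ† c`, hence is compact, and
its square is a positive compact operator commuting with all multiplications. The eigenspaces of the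
square for nonzero eigenvalues are finite-dimensional ideals, in which a joint eigenvector of the
multiplications is a multiple of a minimal idempotent. Minimal idempotents are pairwise orthogonal,
of norm at least `1 / ‖μ‖`, and the same argument inside their orthogonal complement shows that this
complement is the annihilator of `H`. Thus `H ≅ ℓ²(X) ⊕ V`, where `X` is the set of minimal
idempotents weighted by the squares of their norms and `V` is the annihilator, which is also the
Jacobson radical. Composing a proper morphism with the characters of its target yields characters of
its source, that is, a map of the underlying weighted sets in the opposite direction; the remaining
datum is an operator between the annihilators. In finite dimensions a semigroup is semisimple if and
only if it has a unit, and it is then the algebra of functions on a finite set.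
-/

namespace HilbFrob

noncomputable section

open ContinuousLinearMap (adjoint)
open Opposite (op)

/-! ### Eigenvectors -/

section Eigenvectors

theorem exists_joint_eigenvector {k V ι : Type*} [Field k] [IsAlgClosed k] [AddCommGroup V]
    [Module k V] [FiniteDimensional k V] [Nontrivial V] (f : ι → Module.End k V)
    (hf : ∀ i j, Commute (f i) (f j)) : ∃ v ≠ 0, ∀ i, ∃ c : k, f i v = c • v := by
  let A := Algebra.adjoin k (Set.range f)
  have : IsMulCommutative A := Algebra.isMulCommutative_adjoin k <| by
    rintro _ ⟨i, rfl⟩ _ ⟨j, rfl⟩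
    exact hf i j
  have : IsArtinian A V := isArtinian_of_tower k inferInstance
  obtain ⟨U, hU⟩ := IsAtomic.exists_atom (Submodule A V)
  have : IsSimpleModule A U := isSimpleModule_iff_isAtom.2 hU
  have : FiniteDimensional k U := .of_injective (U.restrictScalars k).subtype Subtype.val_injective
  have hU1 : Module.finrank k (U.restrictScalars k) = 1 :=
    IsSimpleModule.finrank_eq_one_of_isMulCommutative A U k
  obtain ⟨v, hv, hspan⟩ := finrank_eq_one_iff'.1 hU1
  refine ⟨v, mt Submodule.coe_eq_zero.1 hv, fun i => ?_⟩
  obtain ⟨c, hc⟩ := hspan ((⟨f i, Algebra.subset_adjoin ⟨i, rfl⟩⟩ : A) • v)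
  exact ⟨c, (congrArg Subtype.val hc).symm⟩

theorem exists_inf_eigenspace_ne_bot {𝕜 E : Type*} [RCLike 𝕜] [NormedAddCommGroup E]
    [InnerProductSpace 𝕜 E] {T : E →L[𝕜] E} (hT : IsCompactOperator T) (hT' : T.IsSymmetric)
    {W : Submodule 𝕜 E} [CompleteSpace W] (hW : ∀ w ∈ W, T w ∈ W) {x : E} (hx : x ∈ W)
    (hTx : T x ≠ 0) : ∃ r ≠ 0, W ⊓ Module.End.eigenspace T.toLinearMap r ≠ ⊥ := by
  let S : W →L[𝕜] W := T.restrict hW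
  have hS : S ≠ 0 := fun h => hTx (congrArg (fun g : W →L[𝕜] W => (g ⟨x, hx⟩ : E)) h)
  have hSc : IsCompactOperator S := hT.restrict' hW
  have hSs : S.IsSymmetric := hT'.restrict_invariant hW
  rw [ne_eq, ← ContinuousLinearMap.eq_zero_of_forall_hasEigenvalue_eq_zero hSc hSs] at hS
  push Not at hS
  obtain ⟨r, hr, hr0⟩ := hS
  obtain ⟨w, hw⟩ := hr.exists_hasEigenvector
  refine ⟨r, hr0, (Submodule.ne_bot_iff _).2 ⟨w, ⟨w.2, ?_⟩, fun h => hw.2 (Subtype.ext h)⟩⟩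
  exact Module.End.mem_eigenspace_iff.2 (congrArg Subtype.val hw.apply_eq_smul)

theorem mem_orthogonal_span_iff {𝕜 E : Type*} [RCLike 𝕜] [NormedAddCommGroup E]
    [InnerProductSpace 𝕜 E] {s : Set E} {x : E} :
    x ∈ (Submodule.span 𝕜 s)ᗮ ↔ ∀ e ∈ s, inner 𝕜 e x = 0 := by
  rw [← Submodule.span_singleton_le_iff_mem, ← Submodule.isOrtho_iff_le, Submodule.isOrtho_comm,
    Submodule.isOrtho_span]
  simp

end Eigenvectors

/-! ### Hilbertian tensors as compact operators -/

namespace HTensor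

variable {E F G E' F' : Type*}
  [NormedAddCommGroup E] [InnerProductSpace ℂ E]
  [NormedAddCommGroup F] [InnerProductSpace ℂ F]
  [NormedAddCommGroup G] [InnerProductSpace ℂ G]
  [NormedAddCommGroup E'] [InnerProductSpace ℂ E']
  [NormedAddCommGroup F'] [InnerProductSpace ℂ F']

/-- The elementary tensor `x ⊗ y` as a bounded bilinear map of `x` and `y`. -/
def tmulL (E F : Type*) [NormedAddCommGroup E] [InnerProductSpace ℂ E]
    [NormedAddCommGroup F] [InnerProductSpace ℂ F] : E →L[ℂ] F →L[ℂ] HTensor E F :=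
  (ContinuousLinearMap.compL ℂ F (E ⊗[ℂ] F) (HTensor E F)
    (incl E F).toContinuousLinearMap) ∘L TensorProduct.mkL ℂ E F

theorem norm_tmul (x : E) (y : F) : ‖tmul x y‖ = ‖x‖ * ‖y‖ := by
  simp [tmul]

theorem clm_ext₃ {L : Type*} [NormedAddCommGroup L] [NormedSpace ℂ L]
    {f g : HTensor (HTensor E F) G →L[ℂ] L}
    (h : ∀ x y z, f (tmul (tmul x y) z) = g (tmul (tmul x y) z)) : f = g :=
  clm_ext fun t z => by
    have : f ∘L (tmulL (HTensor E F) G).flip z = g ∘L (tmulL (HTensor E F) G).flip z :=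
      clm_ext fun x y => h x y z
    exact congrArg (fun k => k t) this

theorem assoc_symm_tmul (x : E) (y : F) (z : G) :
    (assoc E F G).symm (tmul x (tmul y z)) = tmul (tmul x y) z := by
  rw [LinearIsometryEquiv.symm_apply_eq, assoc_tmul]

theorem ext_inner_tmul {s t : HTensor E F}
    (h : ∀ x y, inner ℂ s (tmul x y) = inner ℂ t (tmul x y)) : s = t :=
  (InnerProductSpace.toDualMap ℂ (HTensor E F)).injective (clm_ext h)

theorem adjoint_map [CompleteSpace E] [CompleteSpace F] [CompleteSpace E'] [CompleteSpace F']
    (f : E →L[ℂ] E') (g : F →L[ℂ] F') : adjoint (map f g) = map (adjoint f) (adjoint g) :=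
  clm_ext fun x y => ext_inner_tmul fun a b => by
    simp [map_tmul, inner_tmul, ContinuousLinearMap.adjoint_inner_left]

/-- The bounded conjugate-linear map taking a tensor `t` to the bilinear form
`(a, b) ↦ ⟪t, a ⊗ b⟫`. -/
def contract (E F : Type*) [NormedAddCommGroup E] [InnerProductSpace ℂ E]
    [NormedAddCommGroup F] [InnerProductSpace ℂ F] : HTensor E F →L⋆[ℂ] E →L[ℂ] F →L[ℂ] ℂ :=
  ((tmulL E F).precomp (F →L[ℂ] ℂ) ∘L
    ContinuousLinearMap.compL ℂ F (HTensor E F) ℂ) ∘SL innerSL ℂ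

theorem contract_apply (t : HTensor E F) (a : E) (b : F) :
    contract E F t a b = inner ℂ t (tmul a b) := rfl

theorem contract_tmul (x : E) (y : F) :
    contract E F (tmul x y) =
      (ContinuousLinearMap.id ℂ ℂ).smulRight (innerSL ℂ y) ∘L innerSL ℂ x := by
  ext; simp [contract_apply, inner_tmul]

theorem isCompactOperator_contract (t : HTensor E F) : IsCompactOperator (contract E F t) := by
  let S : Submodule ℂ (HTensor E F) :=
    (compactOperator (RingHom.id ℂ) E (F →L[ℂ] ℂ)).comap (contract E F).toLinearMap
  have hclosed : IsClosed (S : Set (HTensor E F)) :=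
    isClosed_setOfPred_isCompactOperator.preimage (contract E F).continuous
  have hS : S = ⊤ := dense_of_tmul_mem hclosed fun x y => by
    change IsCompactOperator (contract E F (tmul x y))
    rw [contract_tmul]
    have : IsCompactOperator (innerSL ℂ x) :=
      isCompactOperator_of_locallyCompactSpace_dom (innerSL ℂ x)
    exact this.clm_comp ((ContinuousLinearMap.id ℂ ℂ).smulRight (innerSL ℂ y))
  exact (hS ▸ Submodule.mem_top : t ∈ S)

end HTensor

/-! ### The Frobenius condition and module maps -/

section Frobenius

variable {H : Type*} [NormedAddCommGroup H] [InnerProductSpace ℂ H]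

theorem IsCommSemigroup.bil_comm {μ : HTensor H H →L[ℂ] H} (h : IsCommSemigroup μ) (x y : H) :
    bil μ x y = bil μ y x := h.mul_comm x y

theorem IsCommSemigroup.bil_assoc {μ : HTensor H H →L[ℂ] H} (h : IsCommSemigroup μ) (x y z : H) :
    bil μ (bil μ x y) z = bil μ x (bil μ y z) := h.mul_assoc x y z

theorem map_bil_id_apply (μ : HTensor H H →L[ℂ] H) (a : H) (t : HTensor H H) :
    HTensor.map (bil μ a) (.id ℂ H) t =
      HTensor.map μ (.id ℂ H) ((HTensor.assoc H H H).symm (.tmul a t)) := by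
  refine congrArg (fun g => g t) (HTensor.clm_ext (g := HTensor.map μ (.id ℂ H) ∘L
    (HTensor.assoc H H H).symm.toContinuousLinearEquiv.toContinuousLinearMap ∘L
      HTensor.tmulL H (HTensor H H) a) fun x y => ?_)
  change _ = HTensor.map μ _ ((HTensor.assoc H H H).symm (.tmul a (.tmul x y)))
  simp [HTensor.assoc_symm_tmul, HTensor.map_tmul, bil_apply]

theorem map_id_bil_flip_apply (μ : HTensor H H →L[ℂ] H) (b : H) (t : HTensor H H) :
    HTensor.map (.id ℂ H) ((bil μ).flip b) t =
      HTensor.map (.id ℂ H) μ (HTensor.assoc H H H (.tmul t b)) := by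
  refine congrArg (fun g => g t) (HTensor.clm_ext (g := HTensor.map (.id ℂ H) μ ∘L
    (HTensor.assoc H H H).toContinuousLinearEquiv.toContinuousLinearMap ∘L
      (HTensor.tmulL (HTensor H H) H).flip b) fun x y => ?_)
  change _ = HTensor.map _ μ (HTensor.assoc H H H (.tmul (.tmul x y) b))
  simp [HTensor.assoc_tmul, HTensor.map_tmul, bil_apply]

variable [CompleteSpace H]

theorem map_id_comp_adjoint_eq_iff {μ : HTensor H H →L[ℂ] H} {f : H →L[ℂ] H} :
    HTensor.map f (.id ℂ H) ∘L adjoint μ = adjoint μ ∘L f ↔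
      ∀ c d, adjoint f (bil μ c d) = bil μ (adjoint f c) d := by
  rw [← adjoint.injective.eq_iff]
  simp only [ContinuousLinearMap.adjoint_comp, ContinuousLinearMap.adjoint_adjoint,
    HTensor.adjoint_map, ContinuousLinearMap.adjoint_id]
  refine ⟨fun h c d => ?_, fun h => HTensor.clm_ext fun c d => ?_⟩
  · simpa [HTensor.map_tmul, bil_apply] using (congrArg (fun g => g (.tmul c d)) h).symm
  · simpa [HTensor.map_tmul, bil_apply] using (h c d).symm

theorem id_map_comp_adjoint_eq_iff {μ : HTensor H H →L[ℂ] H} {f : H →L[ℂ] H} :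
    HTensor.map (.id ℂ H) f ∘L adjoint μ = adjoint μ ∘L f ↔
      ∀ c d, adjoint f (bil μ c d) = bil μ c (adjoint f d) := by
  rw [← adjoint.injective.eq_iff]
  simp only [ContinuousLinearMap.adjoint_comp, ContinuousLinearMap.adjoint_adjoint,
    HTensor.adjoint_map, ContinuousLinearMap.adjoint_id]
  refine ⟨fun h c d => ?_, fun h => HTensor.clm_ext fun c d => ?_⟩
  · simpa [HTensor.map_tmul, bil_apply] using (congrArg (fun g => g (.tmul c d)) h).symm
  · simpa [HTensor.map_tmul, bil_apply] using (h c d).symm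

theorem isFrobenius_iff {μ : HTensor H H →L[ℂ] H} :
    IsFrobenius μ ↔
      (∀ a c d, adjoint (bil μ a) (bil μ c d) = bil μ (adjoint (bil μ a) c) d) ∧
      ∀ b c d, adjoint ((bil μ).flip b) (bil μ c d) = bil μ c (adjoint ((bil μ).flip b) d) := by
  simp only [← map_id_comp_adjoint_eq_iff, ← id_map_comp_adjoint_eq_iff]
  refine ⟨fun h => ⟨fun a => ?_, fun b => ?_⟩, fun h => ⟨?_, ?_⟩⟩
  · ext x
    simpa [HTensor.map_tmul, bil_apply, map_bil_id_apply] using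
      congrArg (fun g => g (.tmul a x)) h.upper
  · ext x
    simpa [HTensor.map_tmul, bil_apply, map_id_bil_flip_apply] using
      congrArg (fun g => g (.tmul x b)) h.lower
  · refine HTensor.clm_ext fun a x => ?_
    simpa [HTensor.map_tmul, bil_apply, map_bil_id_apply] using
      congrArg (fun g => g x) (h.1 a)
  · refine HTensor.clm_ext fun x b => ?_
    simpa [HTensor.map_tmul, bil_apply, map_id_bil_flip_apply] using
      congrArg (fun g => g x) (h.2 b)

theorem IsCommSemigroup.isFrobenius_iff {μ : HTensor H H →L[ℂ] H} (h : IsCommSemigroup μ) :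
    IsFrobenius μ ↔ ∀ a c d, adjoint (bil μ a) (bil μ c d) = bil μ c (adjoint (bil μ a) d) := by
  have hflip : (bil μ).flip = bil μ :=
    ContinuousLinearMap.ext fun x => ContinuousLinearMap.ext fun y => h.bil_comm y x
  rw [HilbFrob.isFrobenius_iff, hflip]
  refine ⟨fun hF => hF.2, fun hF => ⟨fun a c d => ?_, hF⟩⟩
  rw [h.bil_comm c, hF, h.bil_comm]

end Frobenius

/-! ### The structure of commutative Frobenius semigroups -/

section Structure

variable {H : Type*} [NormedAddCommGroup H] [InnerProductSpace ℂ H]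

/-- The annihilator of `(H, μ)`: the elements whose product with every element is zero. -/
def annihilator (μ : HTensor H H →L[ℂ] H) : Submodule ℂ H := LinearMap.ker (bil μ).toLinearMap

theorem mem_annihilator {μ : HTensor H H →L[ℂ] H} {x : H} :
    x ∈ annihilator μ ↔ ∀ y, bil μ x y = 0 := by
  rw [annihilator, LinearMap.mem_ker]
  exact ContinuousLinearMap.ext_iff

/-- A minimal idempotent: a nonzero idempotent `e` with `e H = ℂ e`. -/
structure IsMinIdempotent (μ : HTensor H H →L[ℂ] H) (e : H) : Prop where
  ne_zero : e ≠ 0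
  mul_self : bil μ e e = e
  exists_smul : ∀ b, ∃ c : ℂ, bil μ e b = c • e

/-- The coordinate functional of the orthogonal projection onto the line spanned by `e`. -/
def coord (e : H) : H →L[ℂ] ℂ := ((‖e‖ : ℂ) ^ 2)⁻¹ • innerSL ℂ e

theorem coord_apply (e x : H) : coord e x = ((‖e‖ : ℂ) ^ 2)⁻¹ * inner ℂ e x := rfl

theorem coord_self {e : H} (he : e ≠ 0) : coord e e = 1 := by
  rw [coord_apply, inner_self_eq_norm_sq_to_K]
  exact inv_mul_cancel₀ (by simpa using he)

theorem coord_eq_zero_iff {e x : H} (he : e ≠ 0) : coord e x = 0 ↔ inner ℂ e x = 0 := by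
  simp [coord_apply, he]

variable [CompleteSpace H] {μ : HTensor H H →L[ℂ] H}

/-- The axioms of a commutative Hilbertian Frobenius semigroup, for an unbundled pair `(H, μ)`. -/
structure IsCommFrobenius (μ : HTensor H H →L[ℂ] H) : Prop
    extends IsCommSemigroup μ, IsFrobenius μ

instance (μ : HTensor H H →L[ℂ] H) : CompleteSpace (annihilator μ) :=
  ((bil μ).isClosed_ker : IsClosed (annihilator μ : Set H)).completeSpace_coe

namespace IsCommFrobenius

theorem adjoint_bil_bil (h : IsCommFrobenius μ) (a c d : H) :
    adjoint (bil μ a) (bil μ c d) = bil μ c (adjoint (bil μ a) d) :=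
  h.isFrobenius_iff.1 h.toIsFrobenius a c d

theorem bil_adjoint_bil (h : IsCommFrobenius μ) (a c : H) :
    bil μ (adjoint (bil μ a) c) = adjoint (bil μ a) ∘L bil μ c := by
  ext d
  rw [ContinuousLinearMap.comp_apply, h.bil_comm c, h.adjoint_bil_bil, h.bil_comm]

theorem isStarNormal_bil (h : IsCommFrobenius μ) (a : H) : IsStarNormal (bil μ a) :=
  ⟨ContinuousLinearMap.ext fun x => h.adjoint_bil_bil a a x⟩

theorem adjoint_bil_eq_zero_iff (h : IsCommFrobenius μ) {a x : H} :
    adjoint (bil μ a) x = 0 ↔ bil μ a x = 0 :=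
  ContinuousLinearMap.IsStarNormal.adjoint_apply_eq_zero_iff (h.isStarNormal_bil a) x

theorem mem_annihilator_of_bil_self (h : IsCommFrobenius μ) {a : H} (ha : bil μ a a = 0) :
    a ∈ annihilator μ := mem_annihilator.2 fun x => by
  have h1 : bil μ a (bil μ a x) = 0 := by
    rw [← h.bil_assoc, ha, map_zero, zero_apply]
  rw [← inner_self_eq_zero (𝕜 := ℂ), ← ContinuousLinearMap.adjoint_inner_right,
    h.adjoint_bil_eq_zero_iff.2 h1, inner_zero_right]

theorem adjoint_bil_of_bil_self (h : IsCommFrobenius μ) {e : H} (he : bil μ e e = e) :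
    adjoint (bil μ e) = bil μ e := by
  have hidem : IsIdempotentElem (bil μ e) := ContinuousLinearMap.ext fun x => by
    change bil μ e (bil μ e x) = bil μ e x
    rw [← h.bil_assoc, he]
  exact hidem.isSelfAdjoint_iff_isStarNormal.2 (h.isStarNormal_bil e)

end IsCommFrobenius

namespace IsMinIdempotent

theorem inner_bil_self (h : IsCommFrobenius μ) {e : H} (he : IsMinIdempotent μ e) (b : H) :
    inner ℂ e (bil μ e b) = inner ℂ e b := by
  rw [← ContinuousLinearMap.adjoint_inner_left, h.adjoint_bil_of_bil_self he.mul_self,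
    he.mul_self]

theorem bil_eq_coord_smul (h : IsCommFrobenius μ) {e : H} (he : IsMinIdempotent μ e) (b : H) :
    bil μ e b = coord e b • e := by
  obtain ⟨c, hc⟩ := he.exists_smul b
  have : coord e b = c := by
    rw [coord_apply, ← he.inner_bil_self h, ← coord_apply, hc, map_smul, coord_self he.ne_zero,
      smul_eq_mul, mul_one]
  rw [hc, this]

theorem coord_bil (h : IsCommFrobenius μ) {e : H} (he : IsMinIdempotent μ e) (a b : H) :
    coord e (bil μ a b) = coord e a * coord e b := by
  rw [coord_apply, ← he.inner_bil_self h, ← coord_apply, ← h.bil_assoc, he.bil_eq_coord_smul h,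
    map_smul, smul_apply, he.bil_eq_coord_smul h, map_smul, map_smul, coord_self he.ne_zero]
  simp

theorem inner_eq_zero (h : IsCommFrobenius μ) {e e' : H} (he : IsMinIdempotent μ e)
    (he' : IsMinIdempotent μ e') (hne : e ≠ e') : inner ℂ e e' = 0 := by
  rw [← coord_eq_zero_iff he.ne_zero]
  by_contra hee'
  have coord_eq_one : ∀ {x y}, IsMinIdempotent μ x → IsMinIdempotent μ y → coord x y ≠ 0 →
      coord x y = 1 := fun {x y} hx hy hxy =>
    mul_left_cancel₀ hxy (by rw [← hx.coord_bil h, hy.mul_self, mul_one])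
  have he'e : coord e' e ≠ 0 := by
    rwa [ne_eq, coord_eq_zero_iff he'.ne_zero, inner_eq_zero_symm, ← coord_eq_zero_iff he.ne_zero]
  refine hne ?_
  calc e = bil μ e e' := by rw [he.bil_eq_coord_smul h, coord_eq_one he he' hee', one_smul]
    _ = e' := by
      rw [h.bil_comm, he'.bil_eq_coord_smul h, coord_eq_one he' he he'e, one_smul]

theorem isMaximalModularIdeal (h : IsCommFrobenius μ) {e : H} (he : IsMinIdempotent μ e) :
    IsMaximalModularIdeal μ (LinearMap.ker (coord e).toLinearMap) :=
  isMaximalModularIdeal_ker (he.coord_bil h) fun h0 =>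
    one_ne_zero ((coord_self he.ne_zero).symm.trans (LinearMap.congr_fun h0 e))

end IsMinIdempotent

namespace IsCommFrobenius

theorem exists_smul_isMinIdempotent (h : IsCommFrobenius μ) {v : H} (hv : v ∉ annihilator μ)
    (hvec : ∀ b, ∃ c : ℂ, bil μ b v = c • v) : ∃ c : ℂ, IsMinIdempotent μ (c • v) := by
  obtain ⟨c, hc⟩ := hvec v
  have hc0 : c ≠ 0 := by
    rintro rfl
    exact hv (h.mem_annihilator_of_bil_self (by rw [hc, zero_smul]))
  have hv0 : v ≠ 0 := fun h0 => hv (h0 ▸ zero_mem _)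
  refine ⟨c⁻¹, smul_ne_zero (inv_ne_zero hc0) hv0, ?_, fun b => ?_⟩
  · rw [map_smul, map_smul, smul_apply, hc, inv_smul_smul₀ hc0]
  · obtain ⟨d, hd⟩ := hvec b
    exact ⟨d, by rw [map_smul, smul_apply, h.bil_comm, hd, smul_comm]⟩

theorem exists_isMinIdempotent_mem (h : IsCommFrobenius μ) {E : Submodule ℂ H}
    [FiniteDimensional ℂ E] (hE : E ≠ ⊥) (hideal : ∀ b, ∀ v ∈ E, bil μ b v ∈ E)
    (hdisj : Disjoint E (annihilator μ)) : ∃ e ∈ E, IsMinIdempotent μ e := by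
  have : Nontrivial E := Submodule.nontrivial_iff_ne_bot.2 hE
  obtain ⟨v, hv0, hv⟩ := exists_joint_eigenvector
    (fun b => (bil μ b).toLinearMap.restrict (hideal b)) fun a b => LinearMap.ext fun x =>
      Subtype.ext (show bil μ a (bil μ b x) = bil μ b (bil μ a x) by
        rw [← h.bil_assoc, h.bil_comm a, h.bil_assoc])
  have hvann : (v : H) ∉ annihilator μ := fun hvN =>
    hv0 (Subtype.ext (Submodule.disjoint_def.1 hdisj v v.2 hvN))
  obtain ⟨c, hc⟩ := h.exists_smul_isMinIdempotent hvann fun b =>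
    (hv b).imp fun c hc => congrArg Subtype.val hc
  exact ⟨c • v, E.smul_mem c v.2, hc⟩

end IsCommFrobenius

/-- The conjugate-linear operator `a ↦ L_a† c`, where `L_a` is the multiplication by `a`; it is
defined as the contraction of the tensor `μ† c`, which makes its compactness visible. -/
def conjOp (μ : HTensor H H →L[ℂ] H) (c : H) : H →L⋆[ℂ] H :=
  ((InnerProductSpace.toDual ℂ H).symm : (H →L[ℂ] ℂ) →L⋆[ℂ] H) ∘SL
    HTensor.contract H H (adjoint μ c)

theorem conjOp_apply (μ : HTensor H H →L[ℂ] H) (c a : H) :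
    conjOp μ c a = adjoint (bil μ a) c := by
  refine ext_inner_right ℂ fun b => ?_
  change inner ℂ ((InnerProductSpace.toDual ℂ H).symm (HTensor.contract H H (adjoint μ c) a)) b = _
  rw [InnerProductSpace.toDual_symm_apply, HTensor.contract_apply,
    ContinuousLinearMap.adjoint_inner_left, ContinuousLinearMap.adjoint_inner_left, bil_apply]

/-- The square of `conjOp μ c`: a positive compact operator commuting with all multiplications. -/
def conjSq (μ : HTensor H H →L[ℂ] H) (c : H) : H →L[ℂ] H := conjOp μ c ∘SL conjOp μ c

theorem conjSq_apply (μ : HTensor H H →L[ℂ] H) (c a : H) :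
    conjSq μ c a = adjoint (bil μ (adjoint (bil μ a) c)) c := by
  change conjOp μ c (conjOp μ c a) = _
  rw [conjOp_apply, conjOp_apply]

theorem isCompactOperator_conjSq (μ : HTensor H H →L[ℂ] H) (c : H) :
    IsCompactOperator (conjSq μ c) :=
  ((HTensor.isCompactOperator_contract (adjoint μ c)).clm_comp
    ((InnerProductSpace.toDual ℂ H).symm : (H →L[ℂ] ℂ) →L⋆[ℂ] H)).clm_comp (conjOp μ c)

theorem IsCommSemigroup.inner_conjSq (h : IsCommSemigroup μ) (c a b : H) :
    inner ℂ (conjSq μ c a) b = inner ℂ (adjoint (bil μ b) c) (adjoint (bil μ a) c) := by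
  rw [conjSq_apply, ContinuousLinearMap.adjoint_inner_left, h.bil_comm,
    ContinuousLinearMap.adjoint_inner_left]

theorem IsCommSemigroup.isSymmetric_conjSq (h : IsCommSemigroup μ) (c : H) :
    (conjSq μ c).IsSymmetric := fun a b => by
  change inner ℂ (conjSq μ c a) b = inner ℂ a (conjSq μ c b)
  rw [← inner_conj_symm a, h.inner_conjSq, h.inner_conjSq, inner_conj_symm]

namespace IsCommFrobenius

theorem conjSq_bil (h : IsCommFrobenius μ) (c b a : H) :
    conjSq μ c (bil μ b a) = bil μ b (conjSq μ c a) := by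
  have hmul : bil μ (bil μ b a) = bil μ a ∘L bil μ b := by
    ext x
    rw [h.bil_comm b a, h.bil_assoc, ContinuousLinearMap.comp_apply]
  rw [conjSq_apply, conjSq_apply, hmul, ContinuousLinearMap.adjoint_comp,
    ContinuousLinearMap.comp_apply, h.bil_adjoint_bil, ContinuousLinearMap.adjoint_comp,
    ContinuousLinearMap.adjoint_adjoint, ContinuousLinearMap.comp_apply, h.adjoint_bil_bil]

theorem exists_conjSq_ne_zero (h : IsCommFrobenius μ) {x : H} (hx : x ∉ annihilator μ) :
    ∃ c, conjSq μ c x ≠ 0 := by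
  contrapose! hx
  refine mem_annihilator.2 fun c => h.adjoint_bil_eq_zero_iff.1 ?_
  rw [← inner_self_eq_zero (𝕜 := ℂ), ← h.inner_conjSq, hx, inner_zero_left]

theorem disjoint_eigenspace_conjSq_annihilator (h : IsCommFrobenius μ) (c : H) {r : ℂ}
    (hr : r ≠ 0) :
    Disjoint (Module.End.eigenspace (conjSq μ c).toLinearMap r) (annihilator μ) :=
  Submodule.disjoint_def.2 fun v hv hvN => by
    have hv0 : conjOp μ c v = 0 := by
      rw [conjOp_apply, h.adjoint_bil_eq_zero_iff]
      exact mem_annihilator.1 hvN c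
    have : r • v = 0 := by
      rw [← Module.End.mem_eigenspace_iff.1 hv]
      exact (congrArg (conjOp μ c) hv0).trans (map_zero _)
    exact (smul_eq_zero.1 this).resolve_left hr

/-- An eigenspace of the compact operator `conjSq μ c` is a finite-dimensional ideal; hence, if
`x` were orthogonal to the minimal idempotents without annihilating `H`, the complement of the
minimal idempotents would contain one. -/
theorem mem_annihilator_of_forall_inner_eq_zero (h : IsCommFrobenius μ) {x : H}
    (hx : ∀ e, IsMinIdempotent μ e → inner ℂ e x = 0) : x ∈ annihilator μ := by
  let W : Submodule ℂ H := (Submodule.span ℂ {e | IsMinIdempotent μ e})ᗮ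
  have mem_W {w : H} : w ∈ W ↔ ∀ e, IsMinIdempotent μ e → inner ℂ e w = 0 :=
    mem_orthogonal_span_iff
  have bil_mem_W (b : H) {w : H} (hw : w ∈ W) : bil μ b w ∈ W := mem_W.2 fun e he => by
    rw [← coord_eq_zero_iff he.ne_zero, he.coord_bil h,
      (coord_eq_zero_iff he.ne_zero).2 (mem_W.1 hw e he), mul_zero]
  by_contra hxN
  obtain ⟨c, hc⟩ := h.exists_conjSq_ne_zero hxN
  have conjSq_mem_W : ∀ w ∈ W, conjSq μ c w ∈ W := fun w hw => mem_W.2 fun e he => by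
    have : conjSq μ c e = coord e (conjSq μ c e) • e := by
      rw [← he.bil_eq_coord_smul h, ← h.conjSq_bil, he.mul_self]
    have hsymm : inner ℂ (conjSq μ c e) w = inner ℂ e (conjSq μ c w) :=
      h.isSymmetric_conjSq c e w
    rw [← hsymm, this, inner_smul_left, mem_W.1 hw e he, mul_zero]
  obtain ⟨r, hr, hE⟩ := exists_inf_eigenspace_ne_bot (isCompactOperator_conjSq μ c)
    (h.isSymmetric_conjSq c) conjSq_mem_W (mem_W.2 hx) hc
  set E := W ⊓ Module.End.eigenspace (conjSq μ c).toLinearMap r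
  have : FiniteDimensional ℂ (Module.End.eigenspace (conjSq μ c).toLinearMap r) :=
    ContinuousLinearMap.finite_dimensional_eigenspace (isCompactOperator_conjSq μ c) r hr
  have hideal : ∀ b, ∀ v ∈ E, bil μ b v ∈ E := fun b v hv => by
    refine ⟨bil_mem_W b hv.1, Module.End.mem_eigenspace_iff.2 ?_⟩
    rw [ContinuousLinearMap.coe_coe, h.conjSq_bil, ← ContinuousLinearMap.coe_coe (conjSq μ c),
      Module.End.mem_eigenspace_iff.1 hv.2, map_smul]
  obtain ⟨e, heE, he⟩ := h.exists_isMinIdempotent_mem hE hideal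
    ((h.disjoint_eigenspace_conjSq_annihilator c hr).mono_left inf_le_right)
  exact he.ne_zero (inner_self_eq_zero.1 (mem_W.1 heE.1 e he))

theorem mem_annihilator_iff (h : IsCommFrobenius μ) {x : H} :
    x ∈ annihilator μ ↔ ∀ e, IsMinIdempotent μ e → inner ℂ e x = 0 := by
  refine ⟨fun hx e he => ?_, h.mem_annihilator_of_forall_inner_eq_zero⟩
  rw [← he.inner_bil_self h, h.bil_comm, mem_annihilator.1 hx, inner_zero_right]

theorem jacobsonRadical_eq_annihilator (h : IsCommFrobenius μ) :
    jacobsonRadical μ = annihilator μ := by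
  refine le_antisymm (fun x hx => ?_) (fun x hx => ?_)
  · refine h.mem_annihilator_of_forall_inner_eq_zero fun e he => ?_
    rw [← coord_eq_zero_iff he.ne_zero]
    exact Submodule.mem_sInf.1 hx _ (he.isMaximalModularIdeal h)
  · refine Submodule.mem_sInf.2 fun I hI => ?_
    obtain ⟨χ, hχ, rfl⟩ := hI.exists_character h.toIsCommSemigroup
    have : χ x * χ x = 0 := by
      rw [← hχ, ← bil_apply, mem_annihilator.1 hx, map_zero]
    exact LinearMap.mem_ker.2 (mul_self_eq_zero.1 this)

end IsCommFrobenius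

end Structure

/-! ### The model semigroups -/

section WeightedPullback

variable {α β : Type*}

theorem sum_norm_mul_comp_sq_le (φ : β → α) (k : β → ℂ) {M : ℝ} (hM : 0 ≤ M)
    (hk : ∀ x, ∀ S : Finset β, (∀ y ∈ S, φ y = x) → ∑ y ∈ S, ‖k y‖ ^ 2 ≤ M)
    (a : lp (fun _ : α => ℂ) 2) (S : Finset β) :
    ∑ y ∈ S, ‖k y * a (φ y)‖ ^ 2 ≤ M * ‖a‖ ^ 2 := by
  classical
  have hfiber : ∀ x ∈ S.image φ, ∑ y ∈ S with φ y = x, ‖k y * a (φ y)‖ ^ 2 ≤ M * ‖a x‖ ^ 2 := by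
    intro x _
    calc ∑ y ∈ S with φ y = x, ‖k y * a (φ y)‖ ^ 2
        = (∑ y ∈ S with φ y = x, ‖k y‖ ^ 2) * ‖a x‖ ^ 2 := by
          rw [Finset.sum_mul]
          refine Finset.sum_congr rfl fun y hy => ?_
          rw [(Finset.mem_filter.1 hy).2, norm_mul, mul_pow]
      _ ≤ M * ‖a x‖ ^ 2 := by
          gcongr
          exact hk x _ fun y hy => (Finset.mem_filter.1 hy).2
  calc ∑ y ∈ S, ‖k y * a (φ y)‖ ^ 2
      = ∑ x ∈ S.image φ, ∑ y ∈ S with φ y = x, ‖k y * a (φ y)‖ ^ 2 :=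
        (Finset.sum_fiberwise_of_maps_to (fun y hy => Finset.mem_image_of_mem φ hy) _).symm
    _ ≤ ∑ x ∈ S.image φ, M * ‖a x‖ ^ 2 := Finset.sum_le_sum hfiber
    _ = M * ∑ x ∈ S.image φ, ‖a x‖ ^ 2 := (Finset.mul_sum ..).symm
    _ ≤ M * ‖a‖ ^ 2 := by
        gcongr
        simpa using lp.sum_rpow_le_norm_rpow (p := 2) (by simp) a (S.image φ)

/-- The operator `a ↦ (y ↦ k y * a (φ y))` on square-summable functions; it is bounded as soon as
the sums of `‖k y‖ ^ 2` over the fibres of `φ` are. -/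
def weightedPullback (φ : β → α) (k : β → ℂ)
    (hk : ∃ M : ℝ, 0 ≤ M ∧ ∀ x, ∀ S : Finset β, (∀ y ∈ S, φ y = x) → ∑ y ∈ S, ‖k y‖ ^ 2 ≤ M) :
    lp (fun _ : α => ℂ) 2 →L[ℂ] lp (fun _ : β => ℂ) 2 :=
  LinearMap.mkContinuousOfExistsBound
    { toFun := fun a => ⟨fun y => k y * a (φ y), by
        obtain ⟨M, hM, hk⟩ := hk
        exact memℓp_gen' (C := M * ‖a‖ ^ 2) fun S => by
          simpa using sum_norm_mul_comp_sq_le φ k hM hk a S⟩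
      map_add' := fun a b => Subtype.ext (funext fun y => mul_add (k y) (a (φ y)) (b (φ y)))
      map_smul' := fun c a => Subtype.ext (funext fun y => mul_left_comm (k y) c (a (φ y))) } <| by
    obtain ⟨M, hM, hk⟩ := hk
    refine ⟨Real.sqrt M, fun a => ?_⟩
    refine lp.norm_le_of_forall_sum_le (by simp) (by positivity) fun S => ?_
    simpa [mul_pow, Real.sq_sqrt hM] using sum_norm_mul_comp_sq_le φ k hM hk a S

end WeightedPullback

namespace WSet

theorem weight_pos (X : WSet.{u}) (x : X.carrier) : 0 < X.weight x := by
  obtain ⟨C, hC, h⟩ := X.weight_bound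
  exact hC.trans_le (h x)

/-- The square root of the weight, as a complex number. -/
def root (X : WSet.{u}) (x : X.carrier) : ℂ := (Real.sqrt (X.weight x) : ℝ)

theorem root_ne_zero (X : WSet.{u}) (x : X.carrier) : X.root x ≠ 0 := by
  simpa [root] using (Real.sqrt_pos.2 (X.weight_pos x)).ne'

theorem norm_root_sq (X : WSet.{u}) (x : X.carrier) : ‖X.root x‖ ^ 2 = X.weight x := by
  simp [root, Real.sq_sqrt (X.weight_pos x).le]

theorem conj_root (X : WSet.{u}) (x : X.carrier) : starRingEnd ℂ (X.root x) = X.root x :=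
  Complex.conj_ofReal _

theorem root_mul_self (X : WSet.{u}) (x : X.carrier) : X.root x * X.root x = X.weight x := by
  rw [root, ← Complex.ofReal_mul, Real.mul_self_sqrt (X.weight_pos x).le]

end WSet

/-- The Hilbert space `ℓ²(X) ⊕ V`. The elements of `ℓ²(X)` are written in the coordinates of an
orthonormal basis; the value at `x` of the function which they represent is given by
`ModelSpace.ev x`. -/
abbrev ModelSpace (X : WSet.{u}) (V : Type*) [NormedAddCommGroup V] [InnerProductSpace ℂ V] :
    Type _ :=
  WithLp 2 (lp (fun _ : X.carrier => ℂ) 2 × V)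

namespace ModelSpace

section Basis

variable (X : WSet.{u}) (V : Type*) [NormedAddCommGroup V] [InnerProductSpace ℂ V]

/-- The inclusion of the first summand. -/
def inl : lp (fun _ : X.carrier => ℂ) 2 →L[ℂ] ModelSpace X V :=
  (WithLp.prodContinuousLinearEquiv 2 ℂ _ V).symm.toContinuousLinearMap ∘L
    ContinuousLinearMap.inl ℂ _ _

/-- The inclusion of the second summand. -/
def inr : V →L[ℂ] ModelSpace X V :=
  (WithLp.prodContinuousLinearEquiv 2 ℂ _ V).symm.toContinuousLinearMap ∘L
    ContinuousLinearMap.inr ℂ _ _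

open scoped Classical in
/-- The standard unit vectors. -/
def unitVec (x : X.carrier) : ModelSpace X V := inl X V (lp.single 2 x 1)

/-- The function which is one at `x` and zero elsewhere; these are the minimal idempotents of the
model. -/
def idem (x : X.carrier) : ModelSpace X V := X.root x • unitVec X V x

variable {X V}

/-- Evaluation at a point: the coordinates normalized so that they are characters. -/
def ev (x : X.carrier) : ModelSpace X V →L[ℂ] ℂ := innerSL ℂ ((X.root x)⁻¹ • unitVec X V x)

theorem inr_fst (v : V) : (inr X V v).fst = 0 := rfl

theorem inr_snd (v : V) : (inr X V v).snd = v := rfl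

theorem inl_fst_add_inr_snd (a : ModelSpace X V) : inl X V a.fst + inr X V a.snd = a :=
  WithLp.ofLp_injective 2 (Prod.ext (add_zero a.fst) (zero_add a.snd))

theorem inner_inr (v : V) (a : ModelSpace X V) : inner ℂ (inr X V v) a = inner ℂ v a.snd := by
  rw [WithLp.prod_inner_apply]
  change inner ℂ (inr X V v).fst a.fst + inner ℂ v a.snd = _
  rw [inr_fst, inner_zero_left, zero_add]

theorem inner_unitVec (x : X.carrier) (a : ModelSpace X V) :
    inner ℂ (unitVec X V x) a = a.fst x := by
  classical
  rw [WithLp.prod_inner_apply]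
  change inner ℂ (lp.single 2 x (1 : ℂ)) a.fst + inner ℂ (0 : V) a.snd = _
  rw [lp.inner_single_left]
  simp

theorem unitVec_fst_self (x : X.carrier) : (unitVec X V x).fst x = 1 := by
  classical
  exact lp.single_apply_self (E := fun _ => ℂ) 2 x 1

theorem unitVec_fst_of_ne {x y : X.carrier} (h : y ≠ x) : (unitVec X V x).fst y = 0 := by
  classical
  exact lp.single_apply_ne (E := fun _ => ℂ) 2 x 1 h

theorem idem_snd (x : X.carrier) : (idem X V x).snd = 0 := smul_zero _

theorem ev_apply (x : X.carrier) (a : ModelSpace X V) : ev x a = (X.root x)⁻¹ * a.fst x := by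
  rw [ev, innerSL_apply_apply, inner_smul_left, inner_unitVec, map_inv₀, X.conj_root]

theorem fst_apply (x : X.carrier) (a : ModelSpace X V) : a.fst x = X.root x * ev x a := by
  rw [ev_apply, mul_inv_cancel_left₀ (X.root_ne_zero x)]

theorem ev_inr (x : X.carrier) (v : V) : ev x (inr X V v) = 0 := by
  rw [ev_apply, inr_fst, lp.coeFn_zero, Pi.zero_apply, mul_zero]

theorem ev_idem_self (x : X.carrier) : ev x (idem X V x) = 1 := by
  rw [idem, map_smul, ev_apply, unitVec_fst_self, mul_one, smul_eq_mul,
    mul_inv_cancel₀ (X.root_ne_zero x)]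

theorem ev_idem_of_ne {x y : X.carrier} (h : y ≠ x) : ev y (idem X V x) = 0 := by
  rw [idem, map_smul, ev_apply, unitVec_fst_of_ne h, mul_zero, smul_zero]

theorem inner_idem (x : X.carrier) (a : ModelSpace X V) :
    inner ℂ (idem X V x) a = X.weight x * ev x a := by
  rw [idem, inner_smul_left, inner_unitVec, fst_apply, ← mul_assoc, X.conj_root, X.root_mul_self]

theorem norm_idem_sq (x : X.carrier) : ‖idem X V x‖ ^ 2 = X.weight x := by
  have := inner_self_eq_norm_sq_to_K (𝕜 := ℂ) (idem X V x)
  rw [inner_idem, ev_idem_self, mul_one] at this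
  exact Complex.ofReal_injective ((Complex.ofReal_pow _ _).trans this.symm)

@[ext]
theorem ext {a b : ModelSpace X V} (h : ∀ x, ev x a = ev x b) (h' : a.snd = b.snd) : a = b := by
  have hfst : a.fst = b.fst := by
    ext x
    rw [fst_apply, fst_apply, h]
  exact WithLp.ofLp_injective 2 (Prod.ext hfst h')

theorem clm_ext {E : Type*} [NormedAddCommGroup E] [NormedSpace ℂ E]
    {f g : ModelSpace X V →L[ℂ] E} (h : ∀ x, f (idem X V x) = g (idem X V x))
    (h' : ∀ v, f (inr X V v) = g (inr X V v)) : f = g := by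
  classical
  have hunit (x) : f (unitVec X V x) = g (unitVec X V x) :=
    smul_right_injective E (X.root_ne_zero x) (by simpa only [idem, map_smul] using h x)
  have hsingle (x) (c : ℂ) :
      f (inl X V (lp.single 2 x c)) = g (inl X V (lp.single 2 x c)) := by
    have hc : inl X V (lp.single 2 x c) = c • unitVec X V x := by
      rw [unitVec, ← map_smul, ← lp.single_smul, smul_eq_mul, mul_one]
    rw [hc, map_smul, map_smul, hunit]
  have hinl (a) : f (inl X V a) = g (inl X V a) := by
    have hsum := lp.hasSum_single (p := 2) (by simp) a
    refine (hsum.mapL (f ∘L inl X V)).unique ?_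
    simpa only [ContinuousLinearMap.comp_apply, hsingle] using hsum.mapL (g ∘L inl X V)
  ext a
  rw [← inl_fst_add_inr_snd a, map_add, map_add, hinl, h']

end Basis

section Mul

variable (X : WSet.{u}) (V : Type*) [NormedAddCommGroup V] [InnerProductSpace ℂ V]

theorem orthonormal_tmul_unitVec :
    Orthonormal ℂ fun x => HTensor.tmul (unitVec X V x) (unitVec X V x) := by
  classical
  rw [orthonormal_iff_ite]
  intro x y
  rw [HTensor.inner_tmul, inner_unitVec]
  split_ifs with h
  · rw [h, unitVec_fst_self, mul_one]
  · rw [unitVec_fst_of_ne h, mul_zero]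

theorem exists_sum_norm_inv_root_sq_le : ∃ M : ℝ, 0 ≤ M ∧
    ∀ x, ∀ S : Finset X.carrier, (∀ y ∈ S, y = x) → ∑ y ∈ S, ‖(X.root y)⁻¹‖ ^ 2 ≤ M := by
  obtain ⟨C, hC, h⟩ := X.weight_bound
  refine ⟨C⁻¹, by positivity, fun x S hS => ?_⟩
  have hsub : S ⊆ {x} := fun y hy => Finset.mem_singleton.2 (hS y hy)
  refine (Finset.sum_le_sum_of_subset_of_nonneg hsub fun _ _ _ => sq_nonneg _).trans ?_
  rw [Finset.sum_singleton, norm_inv, inv_pow, X.norm_root_sq]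
  exact inv_anti₀ hC (h x)

/-- Division by the square root of the weight. -/
def divRoot : lp (fun _ : X.carrier => ℂ) 2 →L[ℂ] lp (fun _ : X.carrier => ℂ) 2 :=
  weightedPullback id (fun x => (X.root x)⁻¹) (exists_sum_norm_inv_root_sq_le X)

/-- The comultiplication of the model. It is diagonal with respect to orthonormal families, so
that its boundedness, and hence that of its adjoint, is evident. -/
def comul : ModelSpace X V →L[ℂ] HTensor (ModelSpace X V) (ModelSpace X V) :=
  (orthonormal_tmul_unitVec X V).orthogonalFamily.linearIsometry.toContinuousLinearMap ∘L
    divRoot X ∘L WithLp.fstL 2 ℂ _ _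

variable {X V}

theorem comul_unitVec (x : X.carrier) : comul X V (unitVec X V x) =
    (X.root x)⁻¹ • HTensor.tmul (unitVec X V x) (unitVec X V x) := by
  classical
  have hdiv : divRoot X (lp.single 2 x 1) = lp.single 2 x (X.root x)⁻¹ := by
    ext y
    change (X.root y)⁻¹ * lp.single (E := fun _ => ℂ) 2 x 1 y = _
    by_cases hy : y = x
    · subst hy; simp
    · simp [hy]
  change (orthonormal_tmul_unitVec X V).orthogonalFamily.linearIsometry
    (divRoot X (lp.single 2 x 1)) = _
  rw [hdiv, OrthogonalFamily.linearIsometry_apply_single]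
  rfl

theorem comul_inr (v : V) : comul X V (inr X V v) = 0 := by
  simp [comul, inr_fst]

variable [CompleteSpace V]

variable (X V) in
/-- The multiplication of the model. -/
def mul : HTensor (ModelSpace X V) (ModelSpace X V) →L[ℂ] ModelSpace X V := adjoint (comul X V)

theorem ev_mul (x : X.carrier) (a b : ModelSpace X V) :
    ev x (mul X V (.tmul a b)) = ev x a * ev x b := by
  rw [ev_apply, ← inner_unitVec, mul, ContinuousLinearMap.adjoint_inner_right, comul_unitVec,
    inner_smul_left, HTensor.inner_tmul, inner_unitVec, inner_unitVec, ev_apply, ev_apply, map_inv₀,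
    X.conj_root]
  ring

theorem mul_snd (a b : ModelSpace X V) : (mul X V (.tmul a b)).snd = 0 := by
  refine ext_inner_left ℂ fun v => ?_
  rw [← inner_inr, mul, ContinuousLinearMap.adjoint_inner_right, comul_inr, inner_zero_left,
    inner_zero_right]

theorem mul_idem (a : ModelSpace X V) (x : X.carrier) :
    mul X V (.tmul a (idem X V x)) = ev x a • idem X V x := by
  ext y
  · rw [ev_mul, map_smul, smul_eq_mul]
    by_cases h : y = x
    · rw [h]
    · rw [ev_idem_of_ne h, mul_zero, mul_zero]
  · rw [mul_snd, WithLp.smul_snd, idem_snd, smul_zero]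

theorem mul_inr (a : ModelSpace X V) (v : V) : mul X V (.tmul a (inr X V v)) = 0 := by
  ext y
  · rw [ev_mul, ev_inr, mul_zero, map_zero]
  · rw [mul_snd, WithLp.zero_snd]

theorem ev_adjoint_bil (a b : ModelSpace X V) (x : X.carrier) :
    ev x (adjoint (bil (mul X V) a) b) = starRingEnd ℂ (ev x a) * ev x b := by
  refine mul_left_cancel₀ (Complex.ofReal_ne_zero.2 (X.weight_pos x).ne') ?_
  rw [← inner_idem, ContinuousLinearMap.adjoint_inner_right, bil_apply, mul_idem,
    inner_smul_left, inner_idem, mul_left_comm]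

theorem adjoint_bil_snd (a b : ModelSpace X V) : (adjoint (bil (mul X V) a) b).snd = 0 := by
  refine ext_inner_left ℂ fun v => ?_
  rw [← inner_inr, ContinuousLinearMap.adjoint_inner_right, bil_apply, mul_inr, inner_zero_left,
    inner_zero_right]

theorem isCommSemigroup_mul : IsCommSemigroup (mul X V) where
  assoc := HTensor.clm_ext₃ fun a b c => by
    ext x
    · simp [HTensor.map_tmul, HTensor.assoc_tmul, ev_mul, mul_assoc]
    · simp [HTensor.map_tmul, HTensor.assoc_tmul, mul_snd]
  comm := HTensor.clm_ext fun a b => by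
    ext x
    · simp [HTensor.comm_tmul, ev_mul, mul_comm]
    · simp [HTensor.comm_tmul, mul_snd]

theorem isFrobenius_mul : IsFrobenius (mul X V) :=
  isCommSemigroup_mul.isFrobenius_iff.2 fun a c d => by
    ext x
    · rw [ev_adjoint_bil, bil_apply, bil_apply, ev_mul, ev_mul, ev_adjoint_bil, mul_left_comm]
    · rw [adjoint_bil_snd, bil_apply, mul_snd]

theorem isMaximalModularIdeal_ker_ev (x : X.carrier) :
    IsMaximalModularIdeal (mul X V) (LinearMap.ker (ev x).toLinearMap) :=
  isMaximalModularIdeal_ker (ev_mul x) fun h =>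
    one_ne_zero ((ev_idem_self x).symm.trans (LinearMap.congr_fun h (idem X V x)))

end Mul

end ModelSpace

/-- The Frobenius semigroup `ℓ²(X) ⊕ V`, with pointwise product on the first summand and zero
product on the second one. -/
def model (X : WSet.{u}) (V : Hilb.{u}) : FrobSem.{u} where
  carrier := ModelSpace X V
  mul := ModelSpace.mul X V
  isCommSemigroup := ModelSpace.isCommSemigroup_mul
  isFrobenius := ModelSpace.isFrobenius_mul

/-! ### The model functor -/

section Morphisms

variable {H K : Type*} [NormedAddCommGroup H] [InnerProductSpace ℂ H]
  [NormedAddCommGroup K] [InnerProductSpace ℂ K]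

theorem IsProper.of_surjective (γ : HTensor K K →L[ℂ] K) {f : H →L[ℂ] K}
    (hf : Function.Surjective f) : IsProper γ f := fun _ hI h =>
  hI.ne_top (eq_top_iff.2 fun y _ => by
    obtain ⟨x, rfl⟩ := hf y
    exact h ⟨x, rfl⟩)

theorem IsSemigroupMap.of_apply {μ : HTensor H H →L[ℂ] H} {γ : HTensor K K →L[ℂ] K}
    {f : H →L[ℂ] K} (h : ∀ x y, f (μ (.tmul x y)) = γ (.tmul (f x) (f y))) :
    IsSemigroupMap μ γ f :=
  HTensor.clm_ext fun x y => by simpa [HTensor.map_tmul] using h x y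

/-- A multiplicative topological isomorphism, as an isomorphism in the category of Frobenius
semigroups and proper morphisms. -/
def FrobSem.isoOfMul {A B : FrobSem.{u}} (U : A.toHilb ≃L[ℂ] B.toHilb)
    (hU : ∀ x y, U (A.mul (.tmul x y)) = B.mul (.tmul (U x) (U y))) : A ≅ B where
  hom := ⟨U.toContinuousLinearMap, .of_apply hU, .of_surjective _ U.surjective⟩
  inv := ⟨U.symm.toContinuousLinearMap, .of_apply fun x y => U.injective (by simp [hU]),
    .of_surjective _ U.symm.surjective⟩
  hom_inv_id := FrobSem.ProperHom.ext (ContinuousLinearMap.ext U.symm_apply_apply)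
  inv_hom_id := FrobSem.ProperHom.ext (ContinuousLinearMap.ext U.apply_symm_apply)

end Morphisms

namespace ModelSpace

variable {X Y : WSet.{u}} {V W : Type*} [NormedAddCommGroup V] [InnerProductSpace ℂ V]
  [NormedAddCommGroup W] [InnerProductSpace ℂ W]

theorem exists_sum_norm_root_div_root_sq_le (φ : WSet.Hom Y X) : ∃ M : ℝ, 0 ≤ M ∧
    ∀ x, ∀ S : Finset Y.carrier, (∀ y ∈ S, φ.toFun y = x) →
      ∑ y ∈ S, ‖Y.root y / X.root (φ.toFun y)‖ ^ 2 ≤ M := by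
  obtain ⟨M, hM, h⟩ := φ.weight_le
  refine ⟨M, hM, fun x S hS => ?_⟩
  calc ∑ y ∈ S, ‖Y.root y / X.root (φ.toFun y)‖ ^ 2
      = (∑ y ∈ S, Y.weight y) / X.weight x := by
        rw [Finset.sum_div]
        refine Finset.sum_congr rfl fun y hy => ?_
        rw [hS y hy, norm_div, div_pow, Y.norm_root_sq, X.norm_root_sq]
    _ ≤ M := by
        rw [div_le_iff₀ (X.weight_pos x)]
        refine le_trans (Finset.sum_le_sum_of_subset_of_nonneg (fun y hy => ?_) fun y _ _ =>
          (Y.weight_pos y).le) (h x)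
        simpa using hS y hy

/-- The operator between models induced by a map of weighted sets, by composition of functions,
and by a bounded operator. -/
def map (φ : WSet.Hom Y X) (g : V →L[ℂ] W) : ModelSpace X V →L[ℂ] ModelSpace Y W :=
  (WithLp.prodContinuousLinearEquiv 2 ℂ _ _).symm.toContinuousLinearMap ∘L
    (weightedPullback φ.toFun _ (exists_sum_norm_root_div_root_sq_le φ) ∘L
      WithLp.fstL 2 ℂ _ _).prod (g ∘L WithLp.sndL 2 ℂ _ _)

theorem ev_map (φ : WSet.Hom Y X) (g : V →L[ℂ] W) (a : ModelSpace X V) (y : Y.carrier) :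
    ev y (map φ g a) = ev (φ.toFun y) a := by
  have h : (map φ g a).fst y = Y.root y / X.root (φ.toFun y) * a.fst (φ.toFun y) := rfl
  have := Y.root_ne_zero y
  rw [ev_apply, ev_apply, h]
  field_simp

theorem map_snd (φ : WSet.Hom Y X) (g : V →L[ℂ] W) (a : ModelSpace X V) :
    (map φ g a).snd = g a.snd := rfl

theorem map_injective {φ φ' : WSet.Hom Y X} {g g' : V →L[ℂ] W} (h : map φ g = map φ' g') :
    φ = φ' ∧ g = g' := by
  constructor
  · refine WSet.Hom.ext (funext fun y => ?_)
    by_contra hne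
    have := ev_map φ g (idem X V (φ.toFun y)) y
    rw [h, ev_map, ev_idem_self, ev_idem_of_ne (Ne.symm hne)] at this
    exact zero_ne_one this
  · ext v
    simpa only [map_snd, inr_snd] using congrArg (fun f => (f (inr X V v)).snd) h

theorem sum_weight_le {f : ModelSpace X V →L[ℂ] ModelSpace Y W} {φ : Y.carrier → X.carrier}
    (hφ : ∀ y a, ev y (f a) = ev (φ y) a) (x : X.carrier) (S : Finset Y.carrier)
    (hS : ∀ y ∈ S, φ y = x) : ∑ y ∈ S, Y.weight y ≤ ‖f‖ ^ 2 * X.weight x := by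
  have hweight : ∀ y ∈ S, Y.weight y = ‖(f (idem X V x)).fst y‖ ^ 2 := fun y hy => by
    rw [fst_apply, hφ, hS y hy, ev_idem_self, mul_one, Y.norm_root_sq]
  calc ∑ y ∈ S, Y.weight y = ∑ y ∈ S, ‖(f (idem X V x)).fst y‖ ^ 2 := Finset.sum_congr rfl hweight
    _ ≤ ‖(f (idem X V x)).fst‖ ^ 2 := by
      simpa using lp.sum_rpow_le_norm_rpow (p := 2) (by simp) (f (idem X V x)).fst S
    _ ≤ ‖f (idem X V x)‖ ^ 2 := by
      rw [WithLp.prod_norm_sq_eq_of_L2]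
      exact le_add_of_nonneg_right (sq_nonneg _)
    _ ≤ (‖f‖ * ‖idem X V x‖) ^ 2 := by gcongr; exact f.le_opNorm _
    _ = ‖f‖ ^ 2 * X.weight x := by rw [mul_pow, norm_idem_sq]

theorem finite_fiber {f : ModelSpace X V →L[ℂ] ModelSpace Y W} {φ : Y.carrier → X.carrier}
    (hφ : ∀ y a, ev y (f a) = ev (φ y) a) (x : X.carrier) : (φ ⁻¹' {x}).Finite := by
  by_contra hinf
  obtain ⟨C, hC, h⟩ := Y.weight_bound
  obtain ⟨n, hn⟩ := exists_nat_gt (‖f‖ ^ 2 * X.weight x / C)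
  rw [div_lt_iff₀ hC] at hn
  obtain ⟨S, hS, rfl⟩ := Set.Infinite.exists_subset_card_eq hinf n
  refine hn.not_ge ?_
  calc S.card * C ≤ ∑ y ∈ S, Y.weight y := by
        rw [← nsmul_eq_mul]
        exact Finset.card_nsmul_le_sum _ _ _ fun y _ => h y
    _ ≤ ‖f‖ ^ 2 * X.weight x := sum_weight_le hφ x S fun y hy => hS hy

variable [CompleteSpace W]

theorem exists_idem_notMem {I : Submodule ℂ (ModelSpace Y W)}
    (hI : IsMaximalModularIdeal (mul Y W) I) : ∃ y, idem Y W y ∉ I := by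
  by_contra! hidem
  have hinr (v) : inr Y W v ∈ I := by
    obtain ⟨χ, hχ, rfl⟩ := hI.exists_character isCommSemigroup_mul
    refine LinearMap.mem_ker.2 (mul_self_eq_zero.1 ?_)
    rw [← hχ, mul_inr, map_zero]
  have : CompleteSpace I := hI.isClosed.completeSpace_coe
  refine hI.ne_top (Submodule.orthogonal_eq_bot_iff.1 (eq_bot_iff.2 fun z hz => ?_))
  rw [Submodule.mem_orthogonal'] at hz
  have hz0 : innerSL ℂ z = 0 := clm_ext (fun x => hz _ (hidem x)) fun v => hz _ (hinr v)
  exact inner_self_eq_zero.1 (congrArg (fun f => f z) hz0)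

theorem isProper_map (φ : WSet.Hom Y X) (g : V →L[ℂ] W) : IsProper (mul Y W) (map φ g) := by
  intro I hI hle
  obtain ⟨y, hy⟩ := exists_idem_notMem hI
  have h := (hI.isIdeal (idem Y W y) _ (hle ⟨idem X V (φ.toFun y), rfl⟩)).2
  rw [mul_idem, ContinuousLinearMap.coe_coe, ev_map, ev_idem_self, one_smul] at h
  exact hy h

variable [CompleteSpace V]

theorem isSemigroupMap_map (φ : WSet.Hom Y X) (g : V →L[ℂ] W) :
    IsSemigroupMap (mul X V) (mul Y W) (map φ g) := .of_apply fun a b => by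
  ext y
  · rw [ev_map, ev_mul, ev_mul, ev_map, ev_map]
  · rw [map_snd, mul_snd, mul_snd, map_zero]

theorem exists_ev_comp {f : ModelSpace X V →L[ℂ] ModelSpace Y W}
    (hf : IsSemigroupMap (mul X V) (mul Y W) f) (hp : IsProper (mul Y W) f) (y : Y.carrier) :
    ∃ x, ∀ a, ev y (f a) = ev x a := by
  have hmul (a b) : ev y (f (mul X V (.tmul a b))) = ev y (f a) * ev y (f b) := by
    rw [hf.apply, ev_mul]
  have hinr (v) : ev y (f (inr X V v)) = 0 := by
    refine mul_self_eq_zero.1 ?_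
    rw [← hmul, mul_inr, map_zero, map_zero]
  obtain ⟨x, hx⟩ : ∃ x, ev y (f (idem X V x)) ≠ 0 := by
    by_contra! h
    have hzero : ev y ∘L f = 0 := clm_ext h hinr
    refine hp _ (isMaximalModularIdeal_ker_ev y) ?_
    rintro _ ⟨a, rfl⟩
    exact congrArg (fun k => k a) hzero
  refine ⟨x, fun a => mul_right_cancel₀ hx ?_⟩
  rw [← hmul, mul_idem, map_smul, map_smul, smul_eq_mul]

theorem snd_apply_eq_snd_apply_inr {f : ModelSpace X V →L[ℂ] ModelSpace Y W}
    (hf : IsSemigroupMap (mul X V) (mul Y W) f) (a : ModelSpace X V) :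
    (f a).snd = (f (inr X V a.snd)).snd := by
  suffices WithLp.sndL 2 ℂ _ _ ∘L f =
      WithLp.sndL 2 ℂ _ _ ∘L f ∘L inr X V ∘L WithLp.sndL 2 ℂ _ _ from
    congrArg (fun k => k a) this
  refine clm_ext (fun x => ?_) fun v => rfl
  have hidem : f (idem X V x) = mul Y W (.tmul (f (idem X V x)) (f (idem X V x))) := by
    rw [← hf.apply, mul_idem, ev_idem_self, one_smul]
  change (f (idem X V x)).snd = (f (inr X V (idem X V x).snd)).snd
  rw [hidem, mul_snd, idem_snd, map_zero, map_zero, WithLp.zero_snd]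

theorem exists_map_eq {f : ModelSpace X V →L[ℂ] ModelSpace Y W}
    (hf : IsSemigroupMap (mul X V) (mul Y W) f) (hp : IsProper (mul Y W) f) :
    ∃ (φ : WSet.Hom Y X) (g : V →L[ℂ] W), map φ g = f := by
  choose φ hφ using exists_ev_comp hf hp
  let Φ : WSet.Hom Y X :=
    { toFun := φ
      finite_fiber := finite_fiber hφ
      weight_le := ⟨‖f‖ ^ 2, sq_nonneg _, fun x => sum_weight_le hφ x _ fun y hy => by
        simpa using hy⟩ }
  refine ⟨Φ, WithLp.sndL 2 ℂ _ _ ∘L f ∘L inr X V, ContinuousLinearMap.ext fun a => ?_⟩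
  ext y
  · rw [ev_map, hφ]
  · rw [map_snd, snd_apply_eq_snd_apply_inr hf]
    rfl

end ModelSpace

/-- The functor sending a weighted set `X` and a Hilbert space `V` to the Frobenius semigroup
`ℓ²(X) ⊕ V`. -/
def modelFunctor : WSet.{u}ᵒᵖ × Hilb.{u} ⥤ FrobSem.{u} where
  obj P := model P.1.unop P.2
  map {P Q} f := (⟨ModelSpace.map f.1.unop f.2, ModelSpace.isSemigroupMap_map _ _,
    ModelSpace.isProper_map _ _⟩ : FrobSem.ProperHom (model P.1.unop P.2) (model Q.1.unop Q.2))
  map_id _ := FrobSem.ProperHom.ext <| ContinuousLinearMap.ext fun _ =>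
    ModelSpace.ext (fun _ => ModelSpace.ev_map _ _ _ _) rfl
  map_comp _ _ := FrobSem.ProperHom.ext <| ContinuousLinearMap.ext fun _ =>
    ModelSpace.ext (fun _ => (ModelSpace.ev_map _ _ _ _).trans
      ((ModelSpace.ev_map _ _ _ _).trans (ModelSpace.ev_map _ _ _ _)).symm) rfl

instance : modelFunctor.{u}.Faithful where
  map_injective h := by
    obtain ⟨hφ, hg⟩ := ModelSpace.map_injective (congrArg FrobSem.ProperHom.toCLM h)
    exact Prod.ext (Quiver.Hom.unop_inj hφ) hg

instance : modelFunctor.{u}.Full where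
  map_surjective {P Q} f := by
    obtain ⟨φ, g, h⟩ := ModelSpace.exists_map_eq f.isSemigroupMap f.isProper
    exact ⟨(Quiver.Hom.op (V := WSet.{u}) (X := Q.1.unop) (Y := P.1.unop) φ, g),
      FrobSem.ProperHom.ext h⟩

/-! ### Essential surjectivity -/

section Decomposition

variable {H : Type u} [NormedAddCommGroup H] [InnerProductSpace ℂ H]

theorem one_le_opNorm_mul_norm {μ : HTensor H H →L[ℂ] H} {e : H} (he0 : e ≠ 0)
    (he : bil μ e e = e) : 1 ≤ ‖μ‖ * ‖e‖ := by
  refine le_of_mul_le_mul_right ?_ (norm_pos_iff.2 he0)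
  calc 1 * ‖e‖ = ‖μ (.tmul e e)‖ := by rw [one_mul, ← bil_apply, he]
    _ ≤ ‖μ‖ * ‖HTensor.tmul e e‖ := μ.le_opNorm _
    _ = ‖μ‖ * ‖e‖ * ‖e‖ := by rw [HTensor.norm_tmul, mul_assoc]

/-- The weighted set of minimal idempotents, with the squares of the norms as weights. -/
abbrev idemWSet (μ : HTensor H H →L[ℂ] H) : WSet.{u} where
  carrier := {e : H // IsMinIdempotent μ e}
  weight e := ‖e.1‖ ^ 2
  weight_bound := by
    refine ⟨((‖μ‖ + 1)⁻¹) ^ 2, by positivity, fun ⟨e, he⟩ => ?_⟩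
    gcongr
    rw [inv_le_iff_one_le_mul₀ (by positivity), mul_comm]
    exact (one_le_opNorm_mul_norm he.ne_zero he.mul_self).trans (by gcongr; simp)

theorem root_idemWSet {μ : HTensor H H →L[ℂ] H} (e : (idemWSet μ).carrier) :
    (idemWSet μ).root e = (‖e.1‖ : ℂ) :=
  congrArg Complex.ofReal (Real.sqrt_sq (norm_nonneg e.1))

variable [CompleteSpace H] {μ : HTensor H H →L[ℂ] H}

namespace IsCommFrobenius

theorem orthonormal_idem (h : IsCommFrobenius μ) :
    Orthonormal ℂ fun e : (idemWSet μ).carrier => ((idemWSet μ).root e)⁻¹ • e.1 := by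
  refine ⟨fun e => ?_, fun e e' hne => ?_⟩
  · rw [norm_smul, norm_inv, root_idemWSet, Complex.norm_real, norm_norm,
      inv_mul_cancel₀ (norm_ne_zero_iff.2 e.2.ne_zero)]
  · change inner ℂ (((idemWSet μ).root e)⁻¹ • e.1) (((idemWSet μ).root e')⁻¹ • e'.1) = 0
    rw [inner_smul_left, inner_smul_right,
      e.2.inner_eq_zero h e'.2 fun hee' => hne (Subtype.ext hee'), mul_zero, mul_zero]

theorem ext_coord (h : IsCommFrobenius μ) {x y : H}
    (hcoord : ∀ e, IsMinIdempotent μ e → coord e x = coord e y)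
    (hinner : ∀ n ∈ annihilator μ, inner ℂ n x = inner ℂ n y) : x = y := by
  have hmem : x - y ∈ annihilator μ := h.mem_annihilator_iff.2 fun e he => by
    rw [← coord_eq_zero_iff he.ne_zero, map_sub, hcoord e he, sub_self]
  rw [← sub_eq_zero, ← inner_self_eq_zero (𝕜 := ℂ), inner_sub_right, hinner _ hmem, sub_self]

theorem inner_bil_of_mem_annihilator (h : IsCommFrobenius μ) {n : H} (hn : n ∈ annihilator μ)
    (x y : H) : inner ℂ n (bil μ x y) = 0 := by
  have : bil μ x n = 0 := by rw [h.bil_comm, mem_annihilator.1 hn]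
  rw [← ContinuousLinearMap.adjoint_inner_left, h.adjoint_bil_eq_zero_iff.2 this, inner_zero_left]

/-- The isometry from `ℓ²` of the minimal idempotents onto their closed span. -/
def idemIsometry (h : IsCommFrobenius μ) : lp (fun _ : (idemWSet μ).carrier => ℂ) 2 →ₗᵢ[ℂ] H :=
  h.orthonormal_idem.orthogonalFamily.linearIsometry

theorem inner_idemIsometry_of_mem_annihilator (h : IsCommFrobenius μ)
    (c : lp (fun _ : (idemWSet μ).carrier => ℂ) 2) {n : H} (hn : n ∈ annihilator μ) :
    inner ℂ (h.idemIsometry c) n = 0 := by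
  rw [inner_eq_zero_symm]
  refine ((h.orthonormal_idem.orthogonalFamily.hasSum_linearIsometry c).mapL
    (innerSL ℂ n)).unique ?_
  convert hasSum_zero using 1
  funext e
  have he : inner ℂ n e.1 = 0 := inner_eq_zero_symm.1 (h.mem_annihilator_iff.1 hn e.1 e.2)
  change inner ℂ n (c e • ((idemWSet μ).root e)⁻¹ • e.1) = 0
  rw [inner_smul_right, inner_smul_right, he, mul_zero, mul_zero]

/-- The isometry from the model `ℓ²(X) ⊕ V` to `H`, where `X` consists of the minimal idempotents
and `V` is the annihilator. -/
def modelIsometry (h : IsCommFrobenius μ) :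
    ModelSpace (idemWSet μ) (annihilator μ) →ₗᵢ[ℂ] H where
  toLinearMap := (h.idemIsometry.toContinuousLinearMap ∘L WithLp.fstL 2 ℂ _ _ +
    (annihilator μ).subtypeL ∘L WithLp.sndL 2 ℂ _ _).toLinearMap
  norm_map' a := by
    have : ‖h.idemIsometry a.fst + a.snd.1‖ ^ 2 = ‖a‖ ^ 2 := by
      rw [WithLp.prod_norm_sq_eq_of_L2, @norm_add_sq ℂ, LinearIsometry.norm_map,
        h.inner_idemIsometry_of_mem_annihilator _ a.snd.2]
      simp
    exact (sq_eq_sq₀ (norm_nonneg _) (norm_nonneg _)).1 this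

theorem modelIsometry_idem (h : IsCommFrobenius μ) (e : (idemWSet μ).carrier) :
    h.modelIsometry (ModelSpace.idem _ _ e) = e.1 := by
  let : DecidableEq (idemWSet μ).carrier := Classical.decEq _
  have hunit : h.modelIsometry (ModelSpace.unitVec _ _ e) = ((idemWSet μ).root e)⁻¹ • e.1 := by
    change h.orthonormal_idem.orthogonalFamily.linearIsometry (lp.single 2 e 1) + 0 = _
    rw [OrthogonalFamily.linearIsometry_apply_single, add_zero]
    exact one_smul ℂ (((idemWSet μ).root e)⁻¹ • e.1)
  rw [ModelSpace.idem, map_smul, hunit, smul_inv_smul₀ ((idemWSet μ).root_ne_zero e)]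

theorem modelIsometry_inr (h : IsCommFrobenius μ) (n : annihilator μ) :
    h.modelIsometry (ModelSpace.inr _ _ n) = n := by
  change h.idemIsometry 0 + n.1 = n.1
  rw [map_zero, zero_add]

theorem coord_modelIsometry (h : IsCommFrobenius μ) (e : (idemWSet μ).carrier)
    (a : ModelSpace (idemWSet μ) (annihilator μ)) :
    coord e.1 (h.modelIsometry a) = ModelSpace.ev e a := by
  have hinner : inner ℂ e.1 (h.modelIsometry a) = (‖e.1‖ : ℂ) ^ 2 * ModelSpace.ev e a :=
    calc inner ℂ e.1 (h.modelIsometry a) = inner ℂ (ModelSpace.idem _ _ e) a := by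
          rw [← h.modelIsometry_idem, LinearIsometry.inner_map_map]
      _ = (‖e.1‖ ^ 2 : ℝ) * ModelSpace.ev e a := ModelSpace.inner_idem e a
      _ = (‖e.1‖ : ℂ) ^ 2 * ModelSpace.ev e a := by rw [Complex.ofReal_pow]
  rw [coord_apply, hinner, inv_mul_cancel_left₀ (by simpa using e.2.ne_zero)]

theorem inner_modelIsometry (h : IsCommFrobenius μ) (n : annihilator μ)
    (a : ModelSpace (idemWSet μ) (annihilator μ)) :
    inner ℂ n.1 (h.modelIsometry a) = inner ℂ n a.snd := by
  rw [← ModelSpace.inner_inr, ← h.modelIsometry.inner_map_map, h.modelIsometry_inr]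

theorem modelIsometry_mul (h : IsCommFrobenius μ)
    (a b : ModelSpace (idemWSet μ) (annihilator μ)) :
    h.modelIsometry (ModelSpace.mul _ _ (.tmul a b)) =
      bil μ (h.modelIsometry a) (h.modelIsometry b) := by
  refine h.ext_coord (fun e he => ?_) fun n hn => ?_
  · rw [he.coord_bil h, h.coord_modelIsometry ⟨e, he⟩, h.coord_modelIsometry ⟨e, he⟩,
      h.coord_modelIsometry ⟨e, he⟩, ModelSpace.ev_mul]
  · rw [h.inner_bil_of_mem_annihilator hn, h.inner_modelIsometry ⟨n, hn⟩, ModelSpace.mul_snd,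
      inner_zero_right]

theorem modelIsometry_surjective (h : IsCommFrobenius μ) : Function.Surjective h.modelIsometry := by
  rw [← LinearIsometry.coe_toLinearMap, ← LinearMap.range_eq_top]
  have : CompleteSpace (LinearMap.range h.modelIsometry.toLinearMap) :=
    h.modelIsometry.isometry.isUniformInducing.isComplete_range.completeSpace_coe
  refine Submodule.orthogonal_eq_bot_iff.1 (eq_bot_iff.2 fun z hz => ?_)
  rw [Submodule.mem_orthogonal] at hz
  refine h.ext_coord (fun e he => ?_) fun n hn => ?_
  · rw [map_zero, coord_eq_zero_iff he.ne_zero]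
    exact hz _ ⟨_, h.modelIsometry_idem ⟨e, he⟩⟩
  · rw [inner_zero_right]
    exact hz _ ⟨_, h.modelIsometry_inr ⟨n, hn⟩⟩

end IsCommFrobenius

end Decomposition

namespace FrobSem

variable (A : FrobSem.{u})

theorem isCommFrobenius : IsCommFrobenius A.mul := ⟨A.isCommSemigroup, A.isFrobenius⟩

/-- The annihilator of a Frobenius semigroup, as a Hilbert space. -/
abbrev annihilatorHilb : Hilb.{u} where
  carrier := annihilator A.mul

/-- Every commutative Hilbertian Frobenius semigroup is isomorphic to the model built from its
minimal idempotents and its annihilator. -/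
def modelIso : model (idemWSet A.mul) A.annihilatorHilb ≅ A :=
  isoOfMul (A := model (idemWSet A.mul) A.annihilatorHilb)
    (LinearIsometryEquiv.ofSurjective A.isCommFrobenius.modelIsometry
      A.isCommFrobenius.modelIsometry_surjective).toContinuousLinearEquiv
    A.isCommFrobenius.modelIsometry_mul

end FrobSem

instance : modelFunctor.{u}.EssSurj where
  mem_essImage A := ⟨(op (idemWSet A.mul), A.annihilatorHilb), ⟨A.modelIso⟩⟩

instance : modelFunctor.{u}.IsEquivalence where

/-! ### Finite-dimensional semigroups -/

section Unit

variable {H K : Type*} [NormedAddCommGroup H] [InnerProductSpace ℂ H]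
  [NormedAddCommGroup K] [InnerProductSpace ℂ K] [CompleteSpace K]

theorem IsCommFrobenius.bil_sum_isMinIdempotent {μ : HTensor K K →L[ℂ] K} (h : IsCommFrobenius μ)
    (hann : annihilator μ = ⊥) [Fintype {e : K // IsMinIdempotent μ e}] (b : K) :
    bil μ (∑ e : {e : K // IsMinIdempotent μ e}, e.1) b = b := by
  refine h.ext_coord (fun e he => ?_) fun n hn => ?_
  · have hsum : coord e (∑ e' : {e : K // IsMinIdempotent μ e}, e'.1) = 1 := by
      rw [map_sum, Finset.sum_eq_single_of_mem ⟨e, he⟩ (Finset.mem_univ _), coord_self he.ne_zero]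
      exact fun e' _ hne => (coord_eq_zero_iff he.ne_zero).2 <|
        he.inner_eq_zero h e'.2 fun hee' => hne (Subtype.ext hee'.symm)
    rw [he.coord_bil h, hsum, one_mul]
  · rw [hann, Submodule.mem_bot] at hn
    rw [hn, inner_zero_left, inner_zero_left]

theorem IsSemigroupMap.map_eq_of_isProper {μ : HTensor H H →L[ℂ] H} {γ : HTensor K K →L[ℂ] K}
    {f : H →L[ℂ] K} (hf : IsSemigroupMap μ γ f) (hp : IsProper γ f) (hγ : IsCommSemigroup γ)
    (hrad : jacobsonRadical γ = ⊥) {u : H} {v : K} (hu : ∀ a, bil μ u a = a)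
    (hv : ∀ b, bil γ v b = b) : f u = v := by
  rw [← sub_eq_zero, ← Submodule.mem_bot ℂ, ← hrad, jacobsonRadical, Submodule.mem_sInf]
  intro I hI
  obtain ⟨χ, hχ, rfl⟩ := hI.exists_character hγ
  obtain ⟨a, ha⟩ : ∃ a, χ (f a) ≠ 0 := by
    by_contra! h
    refine hp _ hI ?_
    rintro _ ⟨a, rfl⟩
    exact h a
  rw [LinearMap.mem_ker, map_sub, sub_eq_zero]
  refine mul_right_cancel₀ ha ?_
  calc χ (f u) * χ (f a) = χ (f (bil μ u a)) := by rw [← hχ, ← hf.apply, bil_apply]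
    _ = χ (bil γ v (f a)) := by rw [hu, hv]
    _ = χ v * χ (f a) := hχ _ _

end Unit

namespace FrobSem

variable {A : FrobSem.{u}}

theorem isSemisimple_iff_annihilator_eq_bot : A.IsSemisimple ↔ annihilator A.mul = ⊥ := by
  rw [IsSemisimple, A.isCommFrobenius.jacobsonRadical_eq_annihilator]

variable (A) in
theorem finite_idemWSet [FiniteDimensional ℂ A.toHilb] : Finite (idemWSet A.mul).carrier :=
  A.isCommFrobenius.orthonormal_idem.linearIndependent.finite

theorem exists_unit [FiniteDimensional ℂ A.toHilb] (hA : A.IsSemisimple) :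
    ∃ u : A.toHilb, ∀ b, bil A.mul u b = b := by
  have := A.finite_idemWSet
  have := Fintype.ofFinite (idemWSet A.mul).carrier
  exact ⟨_, A.isCommFrobenius.bil_sum_isMinIdempotent (isSemisimple_iff_annihilator_eq_bot.1 hA)⟩

end FrobSem

namespace FdFrobMon

theorem bil_unit (A : FdFrobMon.{u}) (b : A.toHilb) : bil A.mul (A.unit 1) b = b := by
  have := congrArg (fun f => f (HTensor.tmul 1 b)) A.unit_mul
  simpa [HTensor.map_tmul, HTensor.lid_tmul, bil_apply] using this

theorem isSemisimpleFd (A : FdFrobMon.{u}) : isSemisimpleFd A.toFrobSem := by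
  refine ⟨FrobSem.isSemisimple_iff_annihilator_eq_bot.2 (eq_bot_iff.2 fun x hx => ?_),
    A.finiteDimensional⟩
  rw [Submodule.mem_bot, ← A.bil_unit x, A.isCommSemigroup.bil_comm, mem_annihilator.1 hx]

theorem Hom.isProper {A B : FdFrobMon.{u}} (f : FdFrobMon.Hom A B) : IsProper B.mul f.toCLM := by
  intro I hI hle
  have hunit : B.unit 1 ∈ I := by
    rw [← f.map_unit]
    exact hle ⟨A.unit 1, rfl⟩
  refine hI.ne_top (eq_top_iff.2 fun b _ => ?_)
  rw [← B.bil_unit b]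
  exact (hI.isIdeal b _ hunit).2

/-- The functor forgetting the unit. -/
def forgetUnit : FdFrobMon.{u} ⥤ SemisimpleFdFrobSem.{u} where
  obj A := ⟨A.toFrobSem, A.isSemisimpleFd⟩
  map {A B} f := ObjectProperty.homMk (⟨f.toCLM, f.isSemigroupMap, f.isProper⟩ :
    FrobSem.ProperHom A.toFrobSem B.toFrobSem)

instance : forgetUnit.{u}.Faithful where
  map_injective h := FdFrobMon.Hom.ext
    (congrArg (fun k => FrobSem.ProperHom.toCLM (InducedCategory.Hom.hom k)) h)

instance : forgetUnit.{u}.Full where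
  map_surjective {A B} f := ⟨⟨f.hom.toCLM, f.hom.isSemigroupMap, ContinuousLinearMap.ext_ring <|
    f.hom.isSemigroupMap.map_eq_of_isProper f.hom.isProper B.isCommSemigroup B.isSemisimpleFd.1
      A.bil_unit B.bil_unit⟩, rfl⟩

/-- The monoid structure of a finite-dimensional Frobenius semigroup with a unit element. -/
def ofUnit (A : FrobSem.{u}) [FiniteDimensional ℂ A.toHilb] (e : A.toHilb)
    (he : ∀ b, bil A.mul e b = b) : FdFrobMon.{u} where
  toFrobSem := A
  unit := ContinuousLinearMap.toSpanSingleton ℂ e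
  finiteDimensional := ‹_›
  unit_mul := HTensor.clm_ext fun c x => by
    have : A.mul (.tmul (c • e) x) = c • x := by
      rw [← bil_apply, map_smul, smul_apply, he]
    simpa [HTensor.map_tmul, HTensor.lid_tmul] using this
  mul_unit := HTensor.clm_ext fun x c => by
    have : A.mul (.tmul x (c • e)) = c • x := by
      rw [← bil_apply, map_smul, A.isCommSemigroup.bil_comm, he]
    simpa [HTensor.map_tmul, HTensor.rid, HTensor.comm_tmul, HTensor.lid_tmul] using this

instance : forgetUnit.{u}.EssSurj where
  mem_essImage A := by
    have := A.property.2
    obtain ⟨e, he⟩ := FrobSem.exists_unit A.property.1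
    exact ⟨ofUnit A.obj e he, ⟨Iso.refl _⟩⟩

instance : forgetUnit.{u}.IsEquivalence where

end FdFrobMon

/-! ### Finite sets -/

/-- A set with constant weight `1`. -/
abbrev WSet.ofType (X : Type u) : WSet.{u} where
  carrier := X
  weight _ := 1
  weight_bound := ⟨1, one_pos, fun _ => le_rfl⟩

/-- Every map out of a finite set is a morphism of weighted sets. -/
def WSet.Hom.ofFinite {X Y : WSet.{u}} [Finite X.carrier] (f : X.carrier → Y.carrier) :
    WSet.Hom X Y where
  toFun := f
  finite_fiber y := Set.toFinite _
  weight_le := by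
    have := Fintype.ofFinite X.carrier
    obtain ⟨C, hC, h⟩ := Y.weight_bound
    have hsum : 0 ≤ ∑ x, X.weight x := Finset.sum_nonneg fun x _ => (X.weight_pos x).le
    refine ⟨(∑ x, X.weight x) / C, by positivity, fun y => ?_⟩
    calc ∑ x ∈ (Set.toFinite (f ⁻¹' {y})).toFinset, X.weight x ≤ ∑ x, X.weight x :=
          Finset.sum_le_sum_of_subset_of_nonneg (Finset.subset_univ _) fun x _ _ =>
            (X.weight_pos x).le
      _ = (∑ x, X.weight x) / C * C := (div_mul_cancel₀ _ hC.ne').symm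
      _ ≤ (∑ x, X.weight x) / C * Y.weight y := by gcongr; exact h y

/-- Weighted sets with finite underlying sets in bijection are isomorphic. -/
def WSet.isoOfFinite {X Y : WSet.{u}} [Finite X.carrier] [Finite Y.carrier]
    (e : X.carrier ≃ Y.carrier) : X ≅ Y where
  hom := WSet.Hom.ofFinite e
  inv := WSet.Hom.ofFinite e.symm
  hom_inv_id := WSet.Hom.ext (funext e.symm_apply_apply)
  inv_hom_id := WSet.Hom.ext (funext e.apply_symm_apply)

/-- The zero Hilbert space. -/
abbrev Hilb.zero : Hilb.{u} where
  carrier := PUnit.{u + 1}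

/-- Hilbert spaces with at most one element are isomorphic. -/
def Hilb.isoOfSubsingleton (V W : Hilb.{u}) [Subsingleton V] [Subsingleton W] : V ≅ W where
  hom := (0 : V →L[ℂ] W)
  inv := (0 : W →L[ℂ] V)
  hom_inv_id := ContinuousLinearMap.ext fun _ => Subsingleton.elim _ _
  inv_hom_id := ContinuousLinearMap.ext fun _ => Subsingleton.elim _ _

/-- The functor sending a finite set to itself, with constant weight, and the zero Hilbert
space. -/
def finSetToPair : FintypeCat.{u}ᵒᵖ ⥤ WSet.{u}ᵒᵖ × Hilb.{u} where
  obj X := (op (WSet.ofType X.unop.obj), Hilb.zero)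
  map {X Y} f :=
    have : Finite (WSet.ofType Y.unop.obj).carrier := Y.unop.property
    (Quiver.Hom.op (V := WSet.{u}) (X := WSet.ofType Y.unop.obj) (Y := WSet.ofType X.unop.obj)
      (WSet.Hom.ofFinite fun y => f.unop y), 𝟙 _)

instance : finSetToPair.{u}.Faithful where
  map_injective h := Quiver.Hom.unop_inj (FintypeCat.hom_ext _ _ fun y =>
    congrFun (congrArg (fun k => WSet.Hom.toFun (Quiver.Hom.unop (Prod.fst k))) h) y)

instance : finSetToPair.{u}.Full where
  map_surjective {X Y} f := by
    refine ⟨Quiver.Hom.op (FintypeCat.homMk fun y => f.1.unop.toFun y), Prod.ext rfl ?_⟩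
    exact ContinuousLinearMap.ext fun _ => Subsingleton.elim (α := PUnit) _ _

namespace ModelSpace

variable {X : WSet.{u}} {V : Type*} [NormedAddCommGroup V] [InnerProductSpace ℂ V]

theorem ev_eq_zero_of_mem_jacobsonRadical [CompleteSpace V] {a : ModelSpace X V}
    (ha : a ∈ jacobsonRadical (mul X V)) (x : X.carrier) : ev x a = 0 := by
  rw [jacobsonRadical, Submodule.mem_sInf] at ha
  exact LinearMap.mem_ker.1 (ha _ (isMaximalModularIdeal_ker_ev x))

theorem jacobsonRadical_mul_eq_bot [CompleteSpace V] [Subsingleton V] :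
    jacobsonRadical (mul X V) = ⊥ :=
  eq_bot_iff.2 fun a ha => ext (b := 0)
    (fun x => by rw [map_zero, ev_eq_zero_of_mem_jacobsonRadical ha]) (Subsingleton.elim _ _)

theorem finiteDimensional [Finite X.carrier] [Subsingleton V] :
    FiniteDimensional ℂ (ModelSpace X V) :=
  FiniteDimensional.of_injective (LinearMap.pi fun x : X.carrier => (ev x).toLinearMap)
    fun _ _ h => ext (congrFun h) (Subsingleton.elim _ _)

end ModelSpace

theorem isSemisimpleFd_model (X : WSet.{u}) [Finite X.carrier] (V : Hilb.{u}) [Subsingleton V] :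
    isSemisimpleFd (model X V) :=
  ⟨ModelSpace.jacobsonRadical_mul_eq_bot (V := V), ModelSpace.finiteDimensional (V := V)⟩

instance : Subsingleton Hilb.zero.{u} := inferInstanceAs (Subsingleton PUnit)

/-- The functor sending a finite set to the semisimple semigroup of functions on it. -/
def finSetModel : FintypeCat.{u}ᵒᵖ ⥤ SemisimpleFdFrobSem.{u} :=
  isSemisimpleFd.lift (finSetToPair ⋙ modelFunctor) fun X =>
    have : Finite (WSet.ofType X.unop.obj).carrier := X.unop.property
    isSemisimpleFd_model (WSet.ofType X.unop.obj) Hilb.zero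

instance : finSetModel.{u}.Faithful :=
  have : (finSetToPair.{u} ⋙ modelFunctor.{u}).Faithful := .comp _ _
  .of_comp_iso (ObjectProperty.liftCompιIso _ (finSetToPair ⋙ modelFunctor) _)

instance : finSetModel.{u}.Full :=
  have : (finSetToPair.{u} ⋙ modelFunctor.{u}).Full := .comp _ _
  .of_comp_faithful_iso (ObjectProperty.liftCompιIso _ (finSetToPair ⋙ modelFunctor) _)

/-- A finite-dimensional semisimple semigroup is isomorphic to the semigroup of functions on its
set of minimal idempotents, since neither the weights nor the annihilator matter. -/
def FrobSem.isoFunctions (A : FrobSem.{u}) [Finite (idemWSet A.mul).carrier]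
    [Subsingleton A.annihilatorHilb] :
    model (WSet.ofType (idemWSet A.mul).carrier) Hilb.zero ≅ A :=
  modelFunctor.mapIso (X := (op (WSet.ofType (idemWSet A.mul).carrier), Hilb.zero))
    (Y := (op (idemWSet A.mul), A.annihilatorHilb))
    (Iso.prod (WSet.isoOfFinite (X := idemWSet A.mul)
      (Y := WSet.ofType (idemWSet A.mul).carrier) (Equiv.refl _)).op
      (Hilb.isoOfSubsingleton _ _)) ≪≫ A.modelIso

instance : finSetModel.{u}.EssSurj where
  mem_essImage A := by
    have := A.property.2
    have := A.obj.finite_idemWSet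
    have : Subsingleton A.obj.annihilatorHilb := Submodule.subsingleton_iff_eq_bot.2
      (FrobSem.isSemisimple_iff_annihilator_eq_bot.1 A.property.1)
    exact ⟨op (FintypeCat.of (idemWSet A.obj.mul).carrier),
      ⟨isSemisimpleFd.isoMk A.obj.isoFunctions⟩⟩

instance : finSetModel.{u}.IsEquivalence where

end

end HilbFrob

theorem mainTheorem11 :
    Nonempty (HilbFrob.FrobSem.{u} ≌ HilbFrob.WSet.{u}ᵒᵖ × HilbFrob.Hilb.{u}) ∧
    Nonempty (HilbFrob.SemisimpleFdFrobSem.{u} ≌ HilbFrob.FdFrobMon.{u}) ∧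
    Nonempty (HilbFrob.FdFrobMon.{u} ≌ FintypeCat.{u}ᵒᵖ) :=
  ⟨⟨HilbFrob.modelFunctor.asEquivalence.symm⟩,
    ⟨HilbFrob.FdFrobMon.forgetUnit.asEquivalence.symm⟩,
    ⟨HilbFrob.FdFrobMon.forgetUnit.asEquivalence.trans
      HilbFrob.finSetModel.asEquivalence.symm⟩⟩
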